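/- Let $\mathsf M=(E,\operatorname{rk})$ be a loopless polymatroid: $E$ is a finite set and $\operatorname{rk}\colon 2^E\to\mathbb Z_{\ge 0}$ satisfies $\operatorname{rk}(\varnothing)=0$, is monotone under inclusion and is submodular, and $\varnothing$ is a flat, where a flat is a set $F\subseteq E$ with $\operatorname{rk}(F\cup\{e\})>\operatorname{rk}(F)$ for all $e\in E\setminus F$. Let $\mathcal L(\mathsf M)$ be the lattice of flats ordered by inclusion, with join $\vee$. Let $\mathcal G\subseteq\mathcal L(\mathsf M)\setminus\{\varnothing\}$ be a building set: for every flat $F$, if $G_1,\dots,G_k$ are the maximal elements of $\{G\in\mathcal G: G\subseteq F\}$, then the join map $\prod_{i}[\varnothing,G_i]\to[\varnothing,F]$ is an isomorphism of lattices and $\operatorname{rk}(F)=\sum_i\operatorname{rk}(G_i)$. For $S\subseteq\mathcal G$ and $F\in\mathcal G$ let $\sup(S,F)$ be the join of all elements of $S$ strictly smaller than $F$. The Chow ring is the graded $\mathbb Q$-algebra $D(\mathsf M,\mathcal G)=\mathbb Q[x_G: G\in\mathcal G]/I$ (each $x_G$ in degree $1$), where $I$ is generated by the elements $$\Big(\prod_{H\in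 S}x_H\Big)\Big(\sum_{H\in\mathcal G,\,H\ge G}x_H\Big)^{\operatorname{rk}(G)-\operatorname{rk}(\sup(S,G))}\qquad (S\subseteq\mathcal G,\ G\in\mathcal G),$$ and $\mathrm H^{\mathcal G}_{\mathsf M}(x)=\sum_{i\ge 0}\dim_{\mathbb Q}D^i(\mathsf M,\mathcal G)\,x^i$ is its Hilbert series. A set $S\subseteq\mathcal G$ is $\mathcal G$-nested if for any two or more pairwise incomparable elements of $S$ their join is not in $\mathcal G$, and it is spanning if the join of all its elements is $E$. For flats $K\subseteq F$, let $\mathsf M|_F/K$ be the polymatroid on $F\setminus K$ with rank function $A\mapsto\operatorname{rk}(A\cup K)-\operatorname{rk}(K)$. For a nonempty loopless polymatroid $\mathsf N$ with ground set $E'$ and rank function $\operatorname{rk}'$, let $\overline\chi_{\mathsf N}(x)=\chi_{\mathsf N}(x)/(x-1)$, where $\chi_{\mathsf N}(x)=\sum_{F\in\mathcal L(\mathsf N)}\mu(\varnothing,F)\,x^{\operatorname{rk}'(E')-\operatorname{rk}'(F)}$ and $\mu$ is the Möbius function of $\mathcal L(\mathsf N)$. Then $$\mathrm H^{\mathcal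 G}_{\mathsf M}(x)=\sum_{S}\ \prod_{F\in S}\overline\chi_{\mathsf M|_F/\sup(S,F)}(x),$$ where the sum is over all spanning $\mathcal G$-nested sets $S$. -/

import Mathlib

/-- A polymatroid: a finite ground set `ground` together with a rank function on its subsets that is
normalized, monotone and submodular. (Values of `rk` outside subsets of `ground` are irrelevant.) -/
structure Polymatroid (α : Type*) [DecidableEq α] where
  ground : Finset α
  rk : Finset α → ℕ
  rk_empty : rk ∅ = 0
  rk_mono : ∀ A B : Finset α, A ⊆ B → B ⊆ ground → rk A ≤ rk B
  rk_submod : ∀ A B : Finset α, A ⊆ ground → B ⊆ ground →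
    rk (A ∪ B) + rk (A ∩ B) ≤ rk A + rk B

namespace Polymatroid

variable {α : Type*} [DecidableEq α]

/-! ### Flats and their lattice -/

/-- A flat: adding any further element of the ground set strictly increases the rank. -/
def IsFlat (M : Polymatroid α) (F : Finset α) : Prop :=
  F ⊆ M.ground ∧ ∀ e ∈ M.ground \ F, M.rk F < M.rk (insert e F)

/-- A polymatroid is loopless if the empty set is a flat. -/
def Loopless (M : Polymatroid α) : Prop := M.IsFlat ∅

/-- The type of flats, ordered by inclusion. -/
abbrev Flat (M : Polymatroid α) : Type _ := {F : Finset α // M.IsFlat F}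

instance (M : Polymatroid α) : Finite M.Flat :=
  Finite.of_injective
    (fun F : M.Flat => (⟨F.1, Finset.mem_powerset.2 F.2.1⟩ : {A // A ∈ M.ground.powerset}))
    (fun _ _ h => Subtype.ext (Subtype.mk.inj h))

noncomputable instance (M : Polymatroid α) : Fintype M.Flat := Fintype.ofFinite _

open Classical in
noncomputable instance (M : Polymatroid α) : LocallyFiniteOrder M.Flat :=
  Fintype.toLocallyFiniteOrder

theorem isFlat_of_separated (M : Polymatroid α) (B : Finset α) (hB : B ⊆ M.ground)
    (h : ∀ e ∈ M.ground \ B, ∃ F, M.IsFlat F ∧ B ⊆ F ∧ e ∉ F) : M.IsFlat B := by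
  refine ⟨hB, fun e he => ?_⟩
  obtain ⟨F, hF, hBF, heF⟩ := h e he
  have heg : e ∈ M.ground := (Finset.mem_sdiff.1 he).1
  have h1 := M.rk_submod (insert e B) F (Finset.insert_subset heg hB) hF.1
  have h2 := hF.2 e (Finset.mem_sdiff.2 ⟨heg, heF⟩)
  have h3 : insert e B ∪ F = insert e F := by
    rw [Finset.insert_union, Finset.union_eq_right.2 hBF]
  have h4 : insert e B ∩ F = B := by
    rw [Finset.insert_inter_of_notMem heF, Finset.inter_eq_left.2 hBF]
  rw [h3, h4] at h1
  omega

open Classical in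
/-- The closure of a set: the elements lying in every flat that contains it. -/
noncomputable def closure (M : Polymatroid α) (A : Finset α) : Finset α :=
  M.ground.filter fun e => ∀ F, M.IsFlat F → A ⊆ F → e ∈ F

theorem mem_closure {M : Polymatroid α} {A : Finset α} {e : α} :
    e ∈ M.closure A ↔ e ∈ M.ground ∧ ∀ F, M.IsFlat F → A ⊆ F → e ∈ F := by
  classical
  simp [closure]

theorem isFlat_closure (M : Polymatroid α) (A : Finset α) : M.IsFlat (M.closure A) := by
  refine M.isFlat_of_separated _ (fun _ hx => (mem_closure.1 hx).1) fun e he => ?_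
  simp only [Finset.mem_sdiff, mem_closure, not_and, not_forall] at he
  obtain ⟨F, hF, hA, heF⟩ := he.2 he.1
  exact ⟨F, hF, fun x hx => (mem_closure.1 hx).2 F hF hA, heF⟩

theorem closure_subset (M : Polymatroid α) {A F : Finset α} (hF : M.IsFlat F) (h : A ⊆ F) :
    M.closure A ⊆ F := fun _ hx => (mem_closure.1 hx).2 F hF h

theorem subset_closure (M : Polymatroid α) {A : Finset α} (hA : A ⊆ M.ground) :
    A ⊆ M.closure A := fun _ hx => mem_closure.2 ⟨hA hx, fun _ _ h => h hx⟩

theorem isFlat_ground (M : Polymatroid α) : M.IsFlat M.ground :=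
  ⟨Finset.Subset.refl _, fun e he => by simp at he⟩

theorem IsFlat.inter {M : Polymatroid α} {F G : Finset α} (hF : M.IsFlat F) (hG : M.IsFlat G) :
    M.IsFlat (F ∩ G) := by
  refine M.isFlat_of_separated _ (Finset.inter_subset_left.trans hF.1) fun e he => ?_
  by_cases h : e ∈ F
  · refine ⟨G, hG, Finset.inter_subset_right, fun hg => ?_⟩
    exact (Finset.mem_sdiff.1 he).2 (Finset.mem_inter.2 ⟨h, hg⟩)
  · exact ⟨F, hF, Finset.inter_subset_left, h⟩

/-- The lattice of flats: the meet is the intersection, the join is the closure of the union. -/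
noncomputable instance (M : Polymatroid α) : Lattice M.Flat where
  sup F G := ⟨M.closure (F.1 ∪ G.1), M.isFlat_closure _⟩
  inf F G := ⟨F.1 ∩ G.1, F.2.inter G.2⟩
  le_sup_left F G := Finset.subset_union_left.trans
    (M.subset_closure (Finset.union_subset F.2.1 G.2.1))
  le_sup_right F G := Finset.subset_union_right.trans
    (M.subset_closure (Finset.union_subset F.2.1 G.2.1))
  sup_le _ _ H h1 h2 := M.closure_subset H.2 (Finset.union_subset h1 h2)
  inf_le_left _ _ := Finset.inter_subset_left
  inf_le_right _ _ := Finset.inter_subset_right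
  le_inf _ _ _ h1 h2 := Finset.subset_inter h1 h2

/-- The top flat is the ground set; the bottom flat is the closure of `∅`, that is, `∅` itself when
the polymatroid is loopless. -/
noncomputable instance (M : Polymatroid α) : BoundedOrder M.Flat where
  top := ⟨M.ground, M.isFlat_ground⟩
  le_top F := F.2.1
  bot := ⟨M.closure ∅, M.isFlat_closure _⟩
  bot_le F := M.closure_subset F.2 (Finset.empty_subset _)

theorem top_val (M : Polymatroid α) : (⊤ : M.Flat).1 = M.ground := rfl

theorem bot_val {M : Polymatroid α} (hM : M.Loopless) : (⊥ : M.Flat).1 = ∅ :=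
  Finset.subset_empty.1 (M.closure_subset hM (Finset.Subset.refl _))

/-! ### Minors -/

/-- The restriction `M|_F`. -/
def restrict (M : Polymatroid α) (F : Finset α) (hF : F ⊆ M.ground) : Polymatroid α where
  ground := F
  rk := M.rk
  rk_empty := M.rk_empty
  rk_mono A B h hB := M.rk_mono A B h (hB.trans hF)
  rk_submod A B hA hB := M.rk_submod A B (hA.trans hF) (hB.trans hF)

/-- The contraction `M/K`, on `E \ K`, with rank function `A ↦ rk (A ∪ K) - rk K`. -/
def contract (M : Polymatroid α) (K : Finset α) (hK : K ⊆ M.ground) : Polymatroid α where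
  ground := M.ground \ K
  rk A := M.rk (A ∪ K) - M.rk K
  rk_empty := by simp
  rk_mono A B h hB := Nat.sub_le_sub_right (M.rk_mono _ _ (Finset.union_subset_union_left h)
    (Finset.union_subset (hB.trans Finset.sdiff_subset) hK)) _
  rk_submod A B hA hB := by
    have hA' := Finset.union_subset (hA.trans Finset.sdiff_subset) hK
    have hB' := Finset.union_subset (hB.trans Finset.sdiff_subset) hK
    have h := M.rk_submod (A ∪ K) (B ∪ K) hA' hB'
    rw [← Finset.union_union_distrib_right, ← Finset.inter_union_distrib_right] at h
    have h1 := M.rk_mono K (A ∪ K) Finset.subset_union_right hA'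
    have h2 := M.rk_mono K (B ∪ K) Finset.subset_union_right hB'
    have h3 := M.rk_mono K (A ∩ B ∪ K) Finset.subset_union_right
      ((Finset.union_subset_union_left Finset.inter_subset_left).trans hA')
    have h4 := M.rk_mono K (A ∪ B ∪ K) Finset.subset_union_right
      (Finset.union_subset (Finset.union_subset (hA.trans Finset.sdiff_subset)
        (hB.trans Finset.sdiff_subset)) hK)
    omega

/-- The minor `M|_F / K` for flats `K ≤ F`. -/
def minor (M : Polymatroid α) (K F : M.Flat) (h : K ≤ F) : Polymatroid α :=
  (M.restrict F.1 F.2.1).contract K.1 h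

/-! ### Characteristic polynomials -/

/-- The characteristic polynomial `∑_F μ(⊥, F) x ^ (rk E - rk F)`, where `μ` is the Möbius function
of the lattice of flats. -/
noncomputable def charPoly (M : Polymatroid α) : Polynomial ℤ :=
  ∑ F : M.Flat, Polynomial.C (IncidenceAlgebra.mu ℤ (⊥ : M.Flat) F) *
    Polynomial.X ^ (M.rk M.ground - M.rk F.1)

/-- The reduced characteristic polynomial `χ_M(x) / (x - 1)`. By `mul_reducedCharPoly` the division
is exact for every nonempty loopless polymatroid. -/
noncomputable def reducedCharPoly (M : Polymatroid α) : Polynomial ℤ :=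
  M.charPoly /ₘ (Polynomial.X - Polynomial.C 1)

theorem mul_reducedCharPoly {M : Polymatroid α} (hM : M.Loopless) (hne : M.ground.Nonempty) :
    (Polynomial.X - Polynomial.C 1) * M.reducedCharPoly = M.charPoly := by
  rw [reducedCharPoly, Polynomial.mul_divByMonic_eq_iff_isRoot, Polynomial.IsRoot.def, charPoly,
    Polynomial.eval_finsetSum]
  have hbt : (⊥ : M.Flat) ≠ ⊤ := fun h => by
    have h' := congrArg Subtype.val h
    rw [bot_val hM, top_val] at h'
    exact hne.ne_empty h'.symm
  have h := IncidenceAlgebra.sum_Icc_mu_right (𝕜 := ℤ) (⊥ : M.Flat) ⊤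
  rw [if_neg hbt, Finset.Icc_bot_top] at h
  simpa using h

/-! ### Building sets and nested sets -/

/-- The set of factors `f(𝒢)`: the maximal elements of `𝒢`. -/
def factors (M : Polymatroid α) (𝒢 : Set M.Flat) : Set M.Flat := {G | Maximal (· ∈ 𝒢) G}

/-- A set `𝒢` of nonempty flats is a building set if for every flat `F`, with `G` running over the
factors of `𝒢_{≤ F}`, the join map `∏_G [∅, G] → [∅, F]` is an isomorphism of lattices and
`rk F = ∑_G rk G`. -/
def IsBuildingSet (M : Polymatroid α) (𝒢 : Finset M.Flat) : Prop :=
  (∀ G ∈ 𝒢, G.1 ≠ ∅) ∧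
  ∀ F : M.Flat,
    (∃ φ : ((G : M.factors {G | G ∈ 𝒢 ∧ G ≤ F}) → Set.Iic G.1) ≃o Set.Iic F,
      ∀ a, IsLUB (Set.range fun G => (a G).1) (φ a).1) ∧
    M.rk F.1 = ∑ᶠ G ∈ M.factors {G | G ∈ 𝒢 ∧ G ≤ F}, M.rk G.1

/-- `S ⊆ 𝒢` is `𝒢`-nested if the join of any at least two pairwise incomparable elements of `S` is
not in `𝒢`. -/
def IsNested (M : Polymatroid α) (𝒢 S : Finset M.Flat) : Prop :=
  S ⊆ 𝒢 ∧ ∀ T ⊆ S, 2 ≤ T.card → IsAntichain (· ≤ ·) (T : Set M.Flat) → T.sup id ∉ 𝒢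

/-- `S` is spanning if the join of all its elements is the ground set. -/
def IsSpanning (M : Polymatroid α) (S : Finset M.Flat) : Prop := (S.sup id).1 = M.ground

open Classical in
/-- The finite set of all spanning `𝒢`-nested sets. -/
noncomputable def spanningNestedSets (M : Polymatroid α) (𝒢 : Finset M.Flat) :
    Finset (Finset M.Flat) :=
  𝒢.powerset.filter fun S => M.IsNested 𝒢 S ∧ M.IsSpanning S

open Classical in
/-- `sup(S, F)`: the join of the elements of `S` that are strictly smaller than `F`. -/
noncomputable def supBelow (M : Polymatroid α) (S : Finset M.Flat) (F : M.Flat) : M.Flat :=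
  (S.filter (· < F)).sup id

theorem supBelow_le (M : Polymatroid α) (S : Finset M.Flat) (F : M.Flat) : M.supBelow S F ≤ F :=
  by classical exact Finset.sup_le fun _ hG => (Finset.mem_filter.1 hG).2.le

/-! ### The Chow ring and its Hilbert series -/

open Classical in
/-- The ideal of `ℚ[x_G : G ∈ 𝒢]` generated by
`(∏_{H ∈ S} x_H) * (∑_{H ∈ 𝒢, H ≥ G} x_H) ^ (rk G - rk sup(S, G))` for all `S ⊆ 𝒢`, `G ∈ 𝒢`. -/
noncomputable def chowIdeal (M : Polymatroid α) (𝒢 : Finset M.Flat) :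
    Ideal (MvPolynomial 𝒢 ℚ) :=
  Ideal.span {p | ∃ (S : Finset 𝒢) (G : 𝒢),
    p = (∏ H ∈ S, MvPolynomial.X H) * (∑ H : 𝒢 with G ≤ H, MvPolynomial.X H) ^
      (M.rk G.1.1 - M.rk (M.supBelow (S.map (Function.Embedding.subtype _)) G.1).1)}

/-- The Chow ring `D(M, 𝒢)`. -/
abbrev ChowRing (M : Polymatroid α) (𝒢 : Finset M.Flat) : Type _ :=
  MvPolynomial 𝒢 ℚ ⧸ M.chowIdeal 𝒢

/-- The graded piece `D^i(M, 𝒢)`: the classes of the homogeneous polynomials of degree `i`. -/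
noncomputable def chowPiece (M : Polymatroid α) (𝒢 : Finset M.Flat) (i : ℕ) :
    Submodule ℚ (M.ChowRing 𝒢) :=
  (MvPolynomial.homogeneousSubmodule 𝒢 ℚ i).map
    (Ideal.Quotient.mkₐ ℚ (M.chowIdeal 𝒢)).toLinearMap

/-- The Hilbert series `∑_i dim D^i(M, 𝒢) x ^ i`, as a formal power series. -/
noncomputable def hilbertSeries (M : Polymatroid α) (𝒢 : Finset M.Flat) : PowerSeries ℤ :=
  PowerSeries.mk fun i => (Module.finrank ℚ (M.chowPiece 𝒢 i) : ℤ)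

end Polymatroid

/-! The proof has an algebraic and a combinatorial half, which meet in a sum over all nested sets,
`nestedMonomialSum`.

Algebra. Let D(U, N) be the variant of the Chow ring with variables from an up-closed U ⊆ 𝒢 only,
where a fixed set N also counts towards the joins in the exponents (`nestedIdeal`). Let G ∈ 𝒢 have
no element of U below it, let y be the sum of the variables strictly above G, and let d = rk G - rk
sup(N, G). Adjoining x_G to D(U, N) imposes (x_G + y)^d = 0, and x_G times every relation of D(U, N
∪ {G}). Division by the monic polynomial (x_G + y)^d then shows that, as graded vector spaces, D(U ∪
{G}, N) ≅ D(U, N) ⊕ ⨁_{0 < i < d} x_G^i D(U, N ∪ {G}), provided that y^d carries the relations of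
D(U, N ∪ {G}) into those of D(U, N). This is `mul_strictUpSum_pow_mem`, a consequence of
submodularity. Adding the elements of 𝒢 one by one, larger ones first, gives the Hilbert series as
the sum over nested N of ∏_{G ∈ N} (x + ⋯ + x^(d_G - 1)), where d_G = rk G - rk sup(N, G).

Combinatorics. Möbius inversion on [K, F] writes x + ⋯ + x^(rk F - rk K - 1) as -1 plus the sum of
the reduced characteristic polynomials of [H, F] over K ≤ H < F. Multiply out: each G ∈ N selects
either some H or the term -1. For fixed selected H's, toggling one suitable element that selects -1
reverses the sign (`sum_isCompatible`). Only spanning nested sets S survive, in which every F ∈ S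
selects H = sup(S, F). -/

/-! ### Remainders modulo a monic polynomial. -/

section DivisionByMonic

open Polynomial

variable {R : Type*} [CommRing R]

/-- Multiplying by X raises the degree to at most that of f, so the quotient is a constant.
Remainders can thus be followed one factor X at a time. -/
theorem coeff_X_mul_modByMonic {f : R[X]} (hf : f.Monic) {q : R[X]} (hq : q.degree < f.degree)
    (r : ℕ) (hr : f.natDegree = r + 1) :
    (X * q) %ₘ f = X * q - C (q.coeff r) * f := by
  nontriviality R
  have hfd : f.degree = ((r + 1 : ℕ) : WithBot ℕ) := by
    rw [degree_eq_natDegree hf.ne_zero, hr]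
  refine (div_modByMonic_unique (C (q.coeff r)) _ hf ⟨by ring, ?_⟩).2
  rw [hfd, degree_lt_iff_coeff_zero]
  intro m hm
  rw [hfd, degree_lt_iff_coeff_zero] at hq
  obtain ⟨m, rfl⟩ : ∃ k, m = k + 1 := ⟨m - 1, by omega⟩
  rw [coeff_sub, coeff_X_mul, coeff_C_mul]
  rcases eq_or_lt_of_le (show r ≤ m by omega) with h | h
  · subst h
    have : f.coeff (r + 1) = 1 := by rw [← hr]; exact hf
    rw [this]; ring
  · rw [hq m (by omega), coeff_eq_zero_of_natDegree_lt (p := f) (by omega)]; ring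

/-- For ideals `I ≤ J` and a monic polynomial `f` of positive degree with `f(0) J ⊆ I`, the
polynomials whose remainder modulo `f` has constant coefficient in `I` and all other coefficients
in `J` form an ideal. -/
noncomputable def remainderIdeal (I J : Ideal R) (hIJ : I ≤ J) (f : R[X]) (hf : f.Monic) (r : ℕ)
    (hr : f.natDegree = r + 1) (h0 : ∀ b ∈ J, b * f.coeff 0 ∈ I) : Ideal R[X] where
  carrier := {q | (q %ₘ f).coeff 0 ∈ I ∧ ∀ i, (q %ₘ f).coeff (i + 1) ∈ J}
  zero_mem' := by simp
  add_mem' {a b} ha hb := by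
    simp only [Set.mem_ofPred_eq, add_modByMonic, coeff_add] at *
    exact ⟨I.add_mem ha.1 hb.1, fun i => J.add_mem (ha.2 i) (hb.2 i)⟩
  smul_mem' c q hq := by
    have hC : ∀ (a : R) (q : R[X]), ((q %ₘ f).coeff 0 ∈ I ∧ ∀ i, (q %ₘ f).coeff (i + 1) ∈ J) →
        (((C a * q) %ₘ f).coeff 0 ∈ I ∧ ∀ i, ((C a * q) %ₘ f).coeff (i + 1) ∈ J) := by
      intro a q hq
      rw [← smul_eq_C_mul, smul_modByMonic]
      simp only [coeff_smul, smul_eq_mul]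
      exact ⟨I.mul_mem_left _ hq.1, fun i => J.mul_mem_left _ (hq.2 i)⟩
    -- Multiplication by X moves the constant coefficient up, harmless since I ≤ J, and makes the
    -- new constant coefficient a multiple of f(0) by an element of J, which lies in I by `h0`.
    have hX : ∀ q : R[X], ((q %ₘ f).coeff 0 ∈ I ∧ ∀ i, (q %ₘ f).coeff (i + 1) ∈ J) →
        (((X * q) %ₘ f).coeff 0 ∈ I ∧ ∀ i, ((X * q) %ₘ f).coeff (i + 1) ∈ J) := by
      intro q hq
      nontriviality R
      have h1 : (X * q) %ₘ f = (X * (q %ₘ f)) %ₘ f := by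
        refine modByMonic_eq_of_dvd_sub hf ?_
        rw [← mul_sub]
        have := dvd_modByMonic_sub q f
        rw [← neg_sub, mul_neg, dvd_neg]
        exact this.mul_left X
      rw [h1, coeff_X_mul_modByMonic hf (degree_modByMonic_lt q hf) r hr]
      have hJ : ∀ i, (q %ₘ f).coeff i ∈ J := fun i => by
        cases i with
        | zero => exact hIJ hq.1
        | succ i => exact hq.2 i
      refine ⟨?_, fun i => ?_⟩
      · rw [coeff_sub, coeff_C_mul, mul_coeff_zero, coeff_X_zero, zero_mul, zero_sub]
        exact I.neg_mem (h0 _ (hJ _))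
      · rw [coeff_sub, coeff_C_mul, coeff_X_mul]
        exact J.sub_mem (hJ _) (J.mul_mem_right _ (hJ _))
    simp only [Set.mem_ofPred_eq, smul_eq_mul] at *
    induction c using Polynomial.induction_on' with
    | add p p' hp hp' =>
      simp only [add_mul, add_modByMonic, coeff_add]
      exact ⟨I.add_mem hp.1 hp'.1, fun i => J.add_mem (hp.2 i) (hp'.2 i)⟩
    | monomial n a =>
      rw [← C_mul_X_pow_eq_monomial, mul_assoc]
      refine hC _ _ ?_
      induction n with
      | zero => simpa using hq
      | succ n ih => rw [pow_succ', mul_assoc]; exact hX _ ih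

theorem mem_remainderIdeal {I J : Ideal R} {hIJ : I ≤ J} {f : R[X]} {hf : f.Monic} {r : ℕ}
    {hr : f.natDegree = r + 1} {h0 : ∀ b ∈ J, b * f.coeff 0 ∈ I} {q : R[X]} :
    q ∈ remainderIdeal I J hIJ f hf r hr h0 ↔
      (q %ₘ f).coeff 0 ∈ I ∧ ∀ i, (q %ₘ f).coeff (i + 1) ∈ J := Iff.rfl

theorem self_mem_remainderIdeal {I J : Ideal R} {hIJ : I ≤ J} {f : R[X]} {hf : f.Monic} {r : ℕ}
    {hr : f.natDegree = r + 1} {h0 : ∀ b ∈ J, b * f.coeff 0 ∈ I} :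
    f ∈ remainderIdeal I J hIJ f hf r hr h0 := by
  rw [mem_remainderIdeal, modByMonic_self hf]
  simp

theorem modByMonic_C {f : R[X]} (hf : f.Monic) (hr : 0 < f.natDegree) (a : R) :
    C a %ₘ f = C a := by
  nontriviality R
  rw [modByMonic_eq_self_iff hf]
  refine degree_C_le.trans_lt ?_
  rwa [← natDegree_pos_iff_degree_pos]

theorem C_mem_remainderIdeal {I J : Ideal R} {hIJ : I ≤ J} {f : R[X]} {hf : f.Monic} {r : ℕ}
    {hr : f.natDegree = r + 1} {h0 : ∀ b ∈ J, b * f.coeff 0 ∈ I} {a : R} (ha : a ∈ I) :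
    C a ∈ remainderIdeal I J hIJ f hf r hr h0 := by
  rw [mem_remainderIdeal, modByMonic_C hf (by omega)]
  simp [ha, coeff_C]

theorem X_mul_C_mem_remainderIdeal {I J : Ideal R} {hIJ : I ≤ J} {f : R[X]} {hf : f.Monic} {r : ℕ}
    {hr : f.natDegree = r + 1} {h0 : ∀ b ∈ J, b * f.coeff 0 ∈ I} {b : R} (hb : b ∈ J) :
    X * C b ∈ remainderIdeal I J hIJ f hf r hr h0 := by
  nontriviality R
  rw [mem_remainderIdeal]
  have hd : (C b).degree < f.degree :=
    degree_C_le.trans_lt (by rw [← natDegree_pos_iff_degree_pos]; omega)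
  rw [coeff_X_mul_modByMonic hf hd r hr]
  have hc : ∀ i, (C b).coeff i ∈ J := fun i => by
    rw [coeff_C]; split_ifs
    exacts [hb, J.zero_mem]
  refine ⟨?_, fun i => ?_⟩
  · rw [coeff_sub, coeff_C_mul, mul_coeff_zero, coeff_X_zero, zero_mul, zero_sub]
    exact I.neg_mem (h0 _ (hc _))
  · rw [coeff_sub, coeff_C_mul, coeff_X_mul]
    exact J.sub_mem (hc _) (J.mul_mem_right _ (hc _))

end DivisionByMonic

/-! ### Division by a homogeneous monic polynomial preserves the grading. -/

section GradedRemainder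

variable {σ K : Type*} [CommRing K]

open Polynomial in
/-- The polynomials over a multivariate polynomial ring that are homogeneous of degree `n`, where
the new variable has degree one. -/
noncomputable def homogeneousPolynomials (σ K : Type*) [CommRing K] (n : ℕ) :
    Submodule K (MvPolynomial σ K)[X] where
  carrier := {q | ∀ i, (i ≤ n → (q.coeff i).IsHomogeneous (n - i)) ∧ (n < i → q.coeff i = 0)}
  zero_mem' i := ⟨fun _ => by simpa using MvPolynomial.isHomogeneous_zero _ _ _, fun _ => by simp⟩
  add_mem' {a b} ha hb i := ⟨fun h => by
      rw [coeff_add]; exact ((ha i).1 h).add ((hb i).1 h),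
    fun h => by rw [coeff_add, (ha i).2 h, (hb i).2 h, add_zero]⟩
  smul_mem' c q hq i := ⟨fun h => by
      rw [coeff_smul]; exact Submodule.smul_mem (MvPolynomial.homogeneousSubmodule σ K _) c
        ((hq i).1 h),
    fun h => by rw [coeff_smul, (hq i).2 h, smul_zero]⟩

open Polynomial

theorem C_mul_mem_homogeneousPolynomials {a : MvPolynomial σ K} {m n : ℕ} (ha : a.IsHomogeneous m)
    {q : (MvPolynomial σ K)[X]} (hq : q ∈ homogeneousPolynomials σ K n) :
    C a * q ∈ homogeneousPolynomials σ K (m + n) := by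
  intro i
  rw [coeff_C_mul]
  by_cases hi : i ≤ n
  · refine ⟨fun _ => ?_, fun h => by omega⟩
    rw [show m + n - i = m + (n - i) by omega]
    exact ha.mul ((hq i).1 hi)
  · rw [(hq i).2 (by omega), mul_zero]
    exact ⟨fun _ => MvPolynomial.isHomogeneous_zero _ _ _, fun _ => rfl⟩

theorem X_mul_mem_homogeneousPolynomials {n : ℕ}
    {q : (MvPolynomial σ K)[X]} (hq : q ∈ homogeneousPolynomials σ K n) :
    X * q ∈ homogeneousPolynomials σ K (n + 1) := by
  intro i
  cases i with
  | zero =>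
    rw [mul_coeff_zero, coeff_X_zero, zero_mul]
    exact ⟨fun _ => MvPolynomial.isHomogeneous_zero _ _ _, fun _ => rfl⟩
  | succ i =>
    rw [coeff_X_mul, Nat.add_sub_add_right]
    exact ⟨fun h => (hq i).1 (by omega), fun h => (hq i).2 (by omega)⟩

theorem X_pow_mem_homogeneousPolynomials (n : ℕ) :
    (X ^ n : (MvPolynomial σ K)[X]) ∈ homogeneousPolynomials σ K n := by
  induction n with
  | zero =>
    intro i
    rw [pow_zero, coeff_one]
    refine ⟨fun h => ?_, fun h => by rw [if_neg (by omega)]⟩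
    rw [if_pos (by omega)]
    simpa using MvPolynomial.isHomogeneous_one _ _
  | succ n ih => rw [pow_succ']; exact X_mul_mem_homogeneousPolynomials ih

theorem X_pow_modByMonic_mem_homogeneousPolynomials {f : (MvPolynomial σ K)[X]} (hf : f.Monic)
    (r : ℕ) (hr : f.natDegree = r + 1) (hfh : f ∈ homogeneousPolynomials σ K (r + 1)) (n : ℕ) :
    (X ^ n) %ₘ f ∈ homogeneousPolynomials σ K n := by
  nontriviality K
  induction n with
  | zero =>
    have := modByMonic_C hf (by omega) (1 : MvPolynomial σ K)
    rw [pow_zero, ← C_1, this, C_1, ← pow_zero X]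
    exact X_pow_mem_homogeneousPolynomials 0
  | succ n ih =>
    have h1 : (X ^ (n + 1)) %ₘ f = (X * (X ^ n %ₘ f)) %ₘ f := by
      refine modByMonic_eq_of_dvd_sub hf ?_
      rw [pow_succ', ← mul_sub, ← neg_sub, mul_neg, dvd_neg]
      exact (dvd_modByMonic_sub (X ^ n) f).mul_left X
    rw [h1, coeff_X_mul_modByMonic hf (degree_modByMonic_lt _ hf) r hr]
    refine Submodule.sub_mem _ (X_mul_mem_homogeneousPolynomials ih) ?_
    by_cases h : r ≤ n
    · have := C_mul_mem_homogeneousPolynomials ((ih r).1 h) hfh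
      rwa [show n - r + (r + 1) = n + 1 by omega] at this
    · rw [(ih r).2 (by omega), C_0, zero_mul]
      exact Submodule.zero_mem _

theorem modByMonic_mem_homogeneousPolynomials {f : (MvPolynomial σ K)[X]} (hf : f.Monic)
    (r : ℕ) (hr : f.natDegree = r + 1) (hfh : f ∈ homogeneousPolynomials σ K (r + 1)) {n : ℕ}
    {q : (MvPolynomial σ K)[X]} (hq : q ∈ homogeneousPolynomials σ K n) :
    q %ₘ f ∈ homogeneousPolynomials σ K n := by
  have : q %ₘ f = ∑ i ∈ q.support, C (q.coeff i) * (X ^ i %ₘ f) := by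
    conv_lhs => rw [q.as_sum_support_C_mul_X_pow]
    rw [← modByMonicHom_apply, map_sum]
    refine Finset.sum_congr rfl fun i _ => ?_
    rw [modByMonicHom_apply, ← smul_eq_C_mul, smul_modByMonic, smul_eq_C_mul]
  rw [this]
  refine Submodule.sum_mem _ fun i _ => ?_
  by_cases h : i ≤ n
  · have := C_mul_mem_homogeneousPolynomials ((hq i).1 h)
      (X_pow_modByMonic_mem_homogeneousPolynomials hf r hr hfh i)
    rwa [show n - i + i = n by omega] at this
  · rw [(hq i).2 (by omega), C_0, zero_mul]
    exact Submodule.zero_mem _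

theorem X_add_C_pow_mem_homogeneousPolynomials {y : MvPolynomial σ K} (hy : y.IsHomogeneous 1)
    (n : ℕ) : ((X + C y) ^ n : (MvPolynomial σ K)[X]) ∈ homogeneousPolynomials σ K n := by
  induction n with
  | zero => simpa using X_pow_mem_homogeneousPolynomials (σ := σ) (K := K) 0
  | succ n ih =>
    rw [pow_succ', add_mul]
    refine Submodule.add_mem _ (X_mul_mem_homogeneousPolynomials ih) ?_
    rw [add_comm n]
    exact C_mul_mem_homogeneousPolynomials hy ih

end GradedRemainder

/-! ### Hilbert functions of quotients of polynomial rings. -/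

section QuotientHilbertFunction

variable {σ K : Type*} [Field K]

/-- The dimension of the degree `n` part of the quotient of a polynomial ring by an ideal. -/
noncomputable def quotientHilbert (I : Ideal (MvPolynomial σ K)) (n : ℕ) : ℕ :=
  Module.finrank K ((MvPolynomial.homogeneousSubmodule σ K n).map
    (Ideal.Quotient.mkₐ K I).toLinearMap)

/-- Both images are the quotient of S by the same kernel. Hilbert functions are compared through
this, without constructing ring isomorphisms. -/
theorem finrank_map_eq_of_ker_eq {V W W' : Type*} [AddCommGroup V] [Module K V] [AddCommGroup W]
    [Module K W] [AddCommGroup W'] [Module K W'] (S : Submodule K V) (f : V →ₗ[K] W)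
    (g : V →ₗ[K] W') (h : ∀ v ∈ S, f v = 0 ↔ g v = 0) :
    Module.finrank K (S.map f) = Module.finrank K (S.map g) := by
  rw [← LinearMap.range_domRestrict, ← LinearMap.range_domRestrict]
  have hk : LinearMap.ker (f.domRestrict S) = LinearMap.ker (g.domRestrict S) := by
    ext v
    simpa using h v v.2
  exact ((LinearMap.quotKerEquivRange _).symm.trans ((Submodule.quotEquivOfEq _ _ hk).trans
    (LinearMap.quotKerEquivRange _))).finrank_eq

theorem finite_map_homogeneousSubmodule [Finite σ] {W : Type*} [AddCommGroup W] [Module K W]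
    (f : MvPolynomial σ K →ₗ[K] W) (n : ℕ) :
    Module.Finite K ((MvPolynomial.homogeneousSubmodule σ K n).map f) :=
  Module.Finite.iff_fg.2 ((MvPolynomial.homogeneousSubmodule_fg (σ := σ) (R := K) n).map f)

theorem quotientHilbert_top (n : ℕ) : quotientHilbert (⊤ : Ideal (MvPolynomial σ K)) n = 0 := by
  have : Subsingleton (MvPolynomial σ K ⧸ (⊤ : Ideal (MvPolynomial σ K))) :=
    Ideal.Quotient.subsingleton_iff.2 rfl
  rw [quotientHilbert]
  exact Module.finrank_zero_of_subsingleton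

end QuotientHilbertFunction

/-! ### Singling out one variable, and the Hilbert function after adjoining it. -/

section SplitVariable

variable {σ K : Type*} [Field K]

open Polynomial

theorem X_add_C_pow_natDegree (y : MvPolynomial σ K) (s : ℕ) :
    ((X + C y) ^ (s + 1) : (MvPolynomial σ K)[X]).natDegree = s + 1 := by
  rw [natDegree_pow, natDegree_X_add_C, mul_one]

theorem X_add_C_pow_coeff_zero (y : MvPolynomial σ K) (s : ℕ) :
    ((X + C y) ^ s : (MvPolynomial σ K)[X]).coeff 0 = y ^ s := by
  rw [coeff_zero_eq_eval_zero]
  simp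

variable [DecidableEq σ]

/-- Polynomials viewed as polynomials in the distinguished variable `g`. -/
noncomputable def splitVar (K : Type*) [Field K] (g : σ) :
    MvPolynomial σ K →ₐ[K] (MvPolynomial σ K)[X] :=
  MvPolynomial.aeval fun i => if i = g then X else C (MvPolynomial.X i)

/-- Setting the variable `g` to zero. -/
noncomputable def killVar (K : Type*) [Field K] (g : σ) :
    MvPolynomial σ K →ₐ[K] MvPolynomial σ K :=
  MvPolynomial.aeval fun i => if i = g then 0 else MvPolynomial.X i

theorem eval_splitVar (g : σ) (p : MvPolynomial σ K) :
    (splitVar K g p).eval (MvPolynomial.X g) = p := by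
  have : ((Polynomial.aeval (R := MvPolynomial σ K) (MvPolynomial.X g)).restrictScalars K).comp
      (splitVar K g) = AlgHom.id K (MvPolynomial σ K) := by
    refine MvPolynomial.algHom_ext fun i => ?_
    by_cases h : i = g <;> simp [splitVar, h]
  simpa [Polynomial.aeval_def] using congrArg (fun φ => φ p) this

theorem map_killVar_splitVar (g : σ) (p : MvPolynomial σ K) :
    (splitVar K g p).map (killVar K g : MvPolynomial σ K →+* MvPolynomial σ K) =
      splitVar K g p := by
  have : (Polynomial.mapAlgHom (killVar K g)).comp (splitVar K g) = splitVar K g := by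
    refine MvPolynomial.algHom_ext fun i => ?_
    by_cases h : i = g <;> simp [splitVar, killVar, h]
  simpa using congrArg (fun φ => φ p) this

theorem splitVar_killVar (g : σ) (p : MvPolynomial σ K) :
    splitVar K g (killVar K g p) = C (killVar K g p) := by
  have : (splitVar K g).comp (killVar K g) =
      (CAlgHom (R := K) (A := MvPolynomial σ K)).comp (killVar K g) := by
    refine MvPolynomial.algHom_ext fun i => ?_
    by_cases h : i = g <;> simp [splitVar, killVar, h]
  simpa using congrArg (fun φ => φ p) this

theorem splitVar_of_killVar_eq {g : σ} {p : MvPolynomial σ K} (h : killVar K g p = p) :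
    splitVar K g p = C p := by
  rw [← h, splitVar_killVar]

theorem splitVar_X_self (g : σ) : splitVar K g (MvPolynomial.X g) = X := by
  simp [splitVar]

theorem killVar_X_of_ne {g i : σ} (h : i ≠ g) :
    killVar K g (MvPolynomial.X i) = MvPolynomial.X i := by
  simp [killVar, h]

theorem killVar_sum {U : Finset σ} {g : σ} (hg : g ∉ U) :
    killVar K g (∑ i ∈ U, MvPolynomial.X i) = ∑ i ∈ U, MvPolynomial.X i := by
  rw [map_sum]
  exact Finset.sum_congr rfl fun i hi => killVar_X_of_ne (by rintro rfl; exact hg hi)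

theorem killVar_prod {U : Finset σ} {g : σ} (hg : g ∉ U) :
    killVar K g (∏ i ∈ U, MvPolynomial.X i) = ∏ i ∈ U, MvPolynomial.X i := by
  rw [map_prod]
  exact Finset.prod_congr rfl fun i hi => killVar_X_of_ne (by rintro rfl; exact hg hi)

theorem sub_killVar_mem {g : σ} {I : Ideal (MvPolynomial σ K)} (hI : MvPolynomial.X g ∈ I)
    (p : MvPolynomial σ K) : p - killVar K g p ∈ I := by
  have : (Ideal.Quotient.mkₐ K I).comp (killVar K g) = Ideal.Quotient.mkₐ K I := by
    refine MvPolynomial.algHom_ext fun i => ?_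
    by_cases h : i = g
    · subst h
      simpa [killVar] using (Ideal.Quotient.eq_zero_iff_mem.2 hI).symm
    · simp [killVar, h]
  refine Ideal.Quotient.eq.1 ?_
  simpa using (congrArg (fun φ => φ p) this).symm

theorem killVar_isHomogeneous (g : σ) {p : MvPolynomial σ K} {n : ℕ} (hp : p.IsHomogeneous n) :
    (killVar K g p).IsHomogeneous n := by
  have := hp.aeval (n := 1) (fun i => if i = g then (0 : MvPolynomial σ K) else MvPolynomial.X i)
    (fun i => by
      split_ifs
      · exact MvPolynomial.isHomogeneous_zero _ _ _
      · exact MvPolynomial.isHomogeneous_X _ _)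
  rwa [one_mul] at this

theorem splitVar_mem_homogeneousPolynomials (g : σ) {p : MvPolynomial σ K} {n : ℕ}
    (hp : p.IsHomogeneous n) : splitVar K g p ∈ homogeneousPolynomials σ K n := by
  have hmon : ∀ (d : σ →₀ ℕ) (c : K), splitVar K g (MvPolynomial.monomial d c) =
      C (MvPolynomial.monomial (d.erase g) c) * X ^ d g := by
    intro d c
    have hd : d = d.erase g + Finsupp.single g (d g) := (Finsupp.erase_add_single g d).symm
    have h1 : MvPolynomial.monomial d c = MvPolynomial.monomial (d.erase g) c *
        (MvPolynomial.X g) ^ d g := by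
      conv_lhs => rw [hd]
      rw [MvPolynomial.X_pow_eq_monomial, MvPolynomial.monomial_mul, mul_one]
    have h2 : killVar K g (MvPolynomial.monomial (d.erase g) c) =
        MvPolynomial.monomial (d.erase g) c := by
      rw [killVar, MvPolynomial.aeval_monomial, MvPolynomial.monomial_eq]
      congr 1
      refine Finsupp.prod_congr fun i hi => ?_
      rw [if_neg]
      rintro rfl
      simp at hi
    rw [h1, map_mul, map_pow, splitVar_X_self, splitVar_of_killVar_eq h2]
  rw [p.as_sum, map_sum]
  refine Submodule.sum_mem _ fun d hd => ?_
  rw [hmon]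
  have hdn : d.degree = n := by
    by_contra h
    exact MvPolynomial.mem_support_iff.1 hd (hp.coeff_eq_zero h)
  have hdeg : (d.erase g).degree + d g = n := by
    rw [← hdn]
    conv_rhs => rw [← Finsupp.erase_add_single g d]
    rw [map_add, Finsupp.degree_single]
  have := C_mul_mem_homogeneousPolynomials
    (MvPolynomial.isHomogeneous_monomial (R := K) (d := d.erase g) (p.coeff d) rfl)
    (X_pow_mem_homogeneousPolynomials (σ := σ) (K := K) (d g))
  rwa [hdeg] at this

variable [Finite σ]

/-- The Hilbert function of the quotient by an ideal that arises from `I ≤ J` by adjoining a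
variable `g` with `(g + y) ^ (s + 1) = 0` and `g J = 0`. -/
theorem quotientHilbert_adjoin (g : σ) (I J I' : Ideal (MvPolynomial σ K)) (hIJ : I ≤ J)
    (hgI : MvPolynomial.X g ∈ I)
    (y : MvPolynomial σ K) (hy : y.IsHomogeneous 1) (s : ℕ)
    (h0 : ∀ b ∈ J, b * ((X + C y) ^ (s + 1) : (MvPolynomial σ K)[X]).coeff 0 ∈ I)
    (hI' : ∀ p, p ∈ I' ↔ splitVar K g p ∈ remainderIdeal I J hIJ ((X + C y) ^ (s + 1))
      ((monic_X_add_C y).pow _) s (X_add_C_pow_natDegree y s) h0) (n : ℕ) :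
    quotientHilbert I' n = quotientHilbert I n +
      ∑ i : Fin s, if (i : ℕ) + 1 ≤ n then quotientHilbert J (n - (i + 1)) else 0 := by
  set f : (MvPolynomial σ K)[X] := (X + C y) ^ (s + 1) with hfdef
  have hf : f.Monic := (monic_X_add_C y).pow _
  have hfd : f.natDegree = s + 1 := X_add_C_pow_natDegree y s
  have hfh : f ∈ homogeneousPolynomials σ K (s + 1) := X_add_C_pow_mem_homogeneousPolynomials hy _
  let ρ : MvPolynomial σ K →ₗ[K] (MvPolynomial σ K)[X] :=
    ((modByMonicHom f).restrictScalars K).comp (splitVar K g).toLinearMap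
  have hρ : ∀ p, ρ p = splitVar K g p %ₘ f := fun p => rfl
  let co : ℕ → (MvPolynomial σ K)[X] →ₗ[K] MvPolynomial σ K :=
    fun i => (lcoeff (MvPolynomial σ K) i).restrictScalars K
  let mI := (Ideal.Quotient.mkₐ K I).toLinearMap
  let mJ := (Ideal.Quotient.mkₐ K J).toLinearMap
  have hmI : ∀ p, mI p = 0 ↔ p ∈ I := fun p => Ideal.Quotient.eq_zero_iff_mem
  have hmJ : ∀ p, mJ p = 0 ↔ p ∈ J := fun p => Ideal.Quotient.eq_zero_iff_mem
  -- A remainder modulo f has coefficients in degrees 0, …, s. The constant one is read modulo I and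
  -- the others modulo J; the index i of `Fin s` stands for degree i + 1. On polynomials of degree n
  -- the kernel is I', and the image is computed in `hrange`.
  let Φ : MvPolynomial σ K →ₗ[K] (MvPolynomial σ K ⧸ I) × (Fin s → MvPolynomial σ K ⧸ J) :=
    LinearMap.prod (mI ∘ₗ co 0 ∘ₗ ρ) (LinearMap.pi fun i => mJ ∘ₗ co (i + 1) ∘ₗ ρ)
  let E : Fin s → Submodule K (MvPolynomial σ K ⧸ J) := fun i =>
    if (i : ℕ) + 1 ≤ n then (MvPolynomial.homogeneousSubmodule σ K (n - (i + 1))).map mJ else ⊥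
  let E0 := (MvPolynomial.homogeneousSubmodule σ K n).map mI
  let Ψ : (E0 × ((i : Fin s) → E i)) →ₗ[K]
      (MvPolynomial σ K ⧸ I) × (Fin s → MvPolynomial σ K ⧸ J) :=
    LinearMap.prodMap E0.subtype (LinearMap.pi fun i => (E i).subtype ∘ₗ LinearMap.proj i)
  have hΨ : Function.Injective Ψ := by
    rintro ⟨a, b⟩ ⟨a', b'⟩ h
    have h1 := congrArg Prod.fst h
    have h2 := congrArg Prod.snd h
    refine Prod.ext (Subtype.ext h1) (funext fun i => Subtype.ext (congrFun h2 i))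
  have hE1 : ∀ i : Fin s, (i : ℕ) + 1 ≤ n →
      E i = (MvPolynomial.homogeneousSubmodule σ K (n - (i + 1))).map mJ := fun i h => if_pos h
  have hE2 : ∀ i : Fin s, ¬ (i : ℕ) + 1 ≤ n → E i = ⊥ := fun i h => if_neg h
  have hEfin : ∀ i, Module.Finite K (E i) := fun i => by
    by_cases h : (i : ℕ) + 1 ≤ n
    · rw [hE1 i h]
      exact finite_map_homogeneousSubmodule _ _
    · rw [hE2 i h]
      infer_instance
  have hE0fin : Module.Finite K E0 := finite_map_homogeneousSubmodule _ _
  have hker : quotientHilbert I' n =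
      Module.finrank K ((MvPolynomial.homogeneousSubmodule σ K n).map Φ) := by
    refine finrank_map_eq_of_ker_eq _ _ _ fun p _ => ?_
    have : (Ideal.Quotient.mkₐ K I').toLinearMap p = 0 ↔ p ∈ I' := Ideal.Quotient.eq_zero_iff_mem
    rw [this, hI', mem_remainderIdeal]
    have : Φ p = 0 ↔ mI ((ρ p).coeff 0) = 0 ∧ ∀ i : Fin s, mJ ((ρ p).coeff (i + 1)) = 0 := by
      rw [Prod.ext_iff, funext_iff]; rfl
    rw [this, hmI, ← hfdef, hρ]
    refine and_congr_right fun _ => ⟨fun h i => (hmJ _).2 (h i), fun h i => ?_⟩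
    by_cases hi : i < s
    · exact (hmJ _).1 (h ⟨i, hi⟩)
    · have : (splitVar K g p %ₘ f).coeff (i + 1) = 0 := by
        refine coeff_eq_zero_of_natDegree_lt ((natDegree_modByMonic_lt _ hf ?_).trans_le ?_)
        · rintro h
          rw [h, natDegree_one] at hfd
          omega
        · omega
      rw [this]; exact J.zero_mem
  have hrange : (MvPolynomial.homogeneousSubmodule σ K n).map Φ = LinearMap.range Ψ := by
    apply le_antisymm
    · rintro _ ⟨p, hp, rfl⟩
      have hr := modByMonic_mem_homogeneousPolynomials hf s hfd hfh
        (splitVar_mem_homogeneousPolynomials g hp)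
      refine ⟨(⟨mI ((ρ p).coeff 0), ⟨_, (hr 0).1 (Nat.zero_le _), rfl⟩⟩,
        fun i => ⟨mJ ((ρ p).coeff (i + 1)), ?_⟩), rfl⟩
      simp only [E]
      split_ifs with h
      · exact ⟨_, (hr _).1 h, rfl⟩
      · have : (ρ p).coeff (i + 1) = 0 := (hr _).2 (by omega)
        rw [this, map_zero]; exact Submodule.zero_mem _
    · rintro _ ⟨⟨⟨_, a, ha, rfl⟩, b⟩, rfl⟩
      have hb : ∀ i : Fin s, ∃ c : MvPolynomial σ K, mJ c = (b i : MvPolynomial σ K ⧸ J) ∧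
          (MvPolynomial.X g ^ ((i : ℕ) + 1) * killVar K g c).IsHomogeneous n := by
        intro i
        have hbi := (b i).2
        simp only [E] at hbi
        split_ifs at hbi with h
        · obtain ⟨c, hc, hcb⟩ := hbi
          refine ⟨c, hcb, ?_⟩
          have := ((MvPolynomial.isHomogeneous_X_pow (R := K) g ((i : ℕ) + 1))).mul
            (killVar_isHomogeneous g hc)
          rwa [show (i : ℕ) + 1 + (n - (i + 1)) = n by omega] at this
        · refine ⟨0, ?_, ?_⟩
          · rw [map_zero]; exact hbi.symm
          · rw [map_zero, mul_zero]; exact MvPolynomial.isHomogeneous_zero _ _ _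
      choose c hcb hch using hb
      -- The representatives are first freed of the variable g, which does not change their classes
      -- since x_g ∈ I ≤ J. The polynomial in x_g built from them has degree at most s and is
      -- therefore its own remainder.
      refine ⟨killVar K g a + ∑ i : Fin s, MvPolynomial.X g ^ ((i : ℕ) + 1) * killVar K g (c i),
        (killVar_isHomogeneous g ha).add
          (MvPolynomial.IsHomogeneous.sum _ _ _ fun i _ => hch i), ?_⟩
      have hsp : splitVar K g (killVar K g a +
          ∑ i : Fin s, MvPolynomial.X g ^ ((i : ℕ) + 1) * killVar K g (c i)) =
          C (killVar K g a) + ∑ i : Fin s, C (killVar K g (c i)) * X ^ ((i : ℕ) + 1) := by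
        rw [map_add, map_sum, splitVar_killVar]
        congr 1
        refine Finset.sum_congr rfl fun i _ => ?_
        rw [map_mul, map_pow, splitVar_killVar, splitVar_X_self, mul_comm]
      have hρq : ρ (killVar K g a +
          ∑ i : Fin s, MvPolynomial.X g ^ ((i : ℕ) + 1) * killVar K g (c i)) =
          C (killVar K g a) + ∑ i : Fin s, C (killVar K g (c i)) * X ^ ((i : ℕ) + 1) := by
        rw [hρ, hsp, modByMonic_eq_self_iff hf, degree_eq_natDegree hf.ne_zero, hfd,
          degree_lt_iff_coeff_zero]
        intro m hm
        rw [coeff_add, coeff_C, if_neg (by omega), zero_add, finsetSum_coeff]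
        refine Finset.sum_eq_zero fun i _ => ?_
        rw [coeff_C_mul, coeff_X_pow, if_neg (by have := i.2; omega), mul_zero]
      have hmk : ∀ (L : Ideal (MvPolynomial σ K)) (_ : MvPolynomial.X g ∈ L) (p),
          (Ideal.Quotient.mkₐ K L).toLinearMap (killVar K g p) =
            (Ideal.Quotient.mkₐ K L).toLinearMap p := fun L hL p =>
        (Ideal.Quotient.eq.2 (sub_killVar_mem hL p)).symm
      refine Prod.ext ?_ (funext fun j => ?_)
      · change mI ((ρ _).coeff 0) = mI a
        rw [hρq, coeff_add, coeff_C_zero, finsetSum_coeff, Finset.sum_eq_zero, add_zero]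
        · exact hmk I hgI a
        · intro i _
          rw [coeff_C_mul, coeff_X_pow, if_neg (by omega), mul_zero]
      · change mJ ((ρ _).coeff (j + 1)) = b j
        rw [hρq, coeff_add, coeff_C, if_neg (by omega), zero_add, finsetSum_coeff,
          Finset.sum_eq_single j]
        · rw [coeff_C_mul, coeff_X_pow, if_pos rfl, mul_one, ← hcb]
          exact hmk J (hIJ hgI) _
        · intro i _ hij
          rw [coeff_C_mul, coeff_X_pow, if_neg, mul_zero]
          intro h
          exact hij (Fin.ext (by omega))
        · simp
  rw [hker, hrange, LinearMap.finrank_range_of_inj hΨ, Module.finrank_prod,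
    Module.finrank_pi_fintype]
  congr 1
  refine Finset.sum_congr rfl fun i _ => ?_
  by_cases h : (i : ℕ) + 1 ≤ n
  · rw [hE1 i h, if_pos h]
    rfl
  · rw [hE2 i h, if_neg h]
    exact finrank_bot _ _

end SplitVariable

/-! ### The relations of the generalised Chow ring, and adjoining a minimal variable. -/

section NestedIdeal

open scoped Classical

variable {L : Type*} [Lattice L]

open MvPolynomial

/-- The sum of the variables indexed by the elements of `U` above `F`. -/
noncomputable def upSum (U : Finset L) (F : L) : MvPolynomial L ℚ :=
  ∑ H ∈ U.filter (F ≤ ·), X H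

/-- The sum of the variables indexed by the elements of `U` strictly above `G`. -/
noncomputable def strictUpSum (U : Finset L) (G : L) : MvPolynomial L ℚ :=
  ∑ H ∈ U.filter (G < ·), X H

theorem upSum_insert {U : Finset L} {G F : L} (h : ¬ F ≤ G) : upSum (insert G U) F = upSum U F := by
  rw [upSum, upSum, Finset.filter_insert, if_neg h]

theorem upSum_insert_self {U : Finset L} {G : L} (hG : G ∉ U) :
    upSum (insert G U) G = X G + strictUpSum U G := by
  rw [upSum, Finset.filter_insert, if_pos le_rfl, Finset.sum_insert, strictUpSum]
  · congr 1
    refine Finset.sum_congr (Finset.filter_congr fun H hH => ?_) fun _ _ => rfl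
    exact ⟨fun h => lt_of_le_of_ne h (by rintro rfl; exact hG hH), le_of_lt⟩
  · exact fun h => hG (Finset.filter_subset _ _ h)

variable [OrderBot L]

/-- The join of the elements of `S` strictly below `F`. -/
noncomputable def joinBelow (S : Finset L) (F : L) : L := (S.filter (· < F)).sup id

theorem le_joinBelow {S : Finset L} {F a : L} (ha : a ∈ S) (h : a < F) : a ≤ joinBelow S F :=
  Finset.le_sup (f := id) (Finset.mem_filter.2 ⟨ha, h⟩)

theorem joinBelow_le_iff {S : Finset L} {F b : L} :
    joinBelow S F ≤ b ↔ ∀ a ∈ S, a < F → a ≤ b := by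
  simp [joinBelow, Finset.sup_le_iff]

theorem joinBelow_le (S : Finset L) (F : L) : joinBelow S F ≤ F :=
  joinBelow_le_iff.2 fun _ _ h => h.le

theorem joinBelow_mono {S T : Finset L} (h : S ⊆ T) (F : L) : joinBelow S F ≤ joinBelow T F :=
  joinBelow_le_iff.2 fun _ ha haF => le_joinBelow (h ha) haF

theorem joinBelow_congr {S T : Finset L} {F : L} (h : ∀ a < F, (a ∈ S ↔ a ∈ T)) :
    joinBelow S F = joinBelow T F :=
  le_antisymm (joinBelow_le_iff.2 fun a ha haF => le_joinBelow ((h a haF).1 ha) haF)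
    (joinBelow_le_iff.2 fun a ha haF => le_joinBelow ((h a haF).2 ha) haF)

theorem joinBelow_union_empty (S : Finset L) (F : L) : joinBelow (S ∪ ∅) F = joinBelow S F := by
  rw [Finset.union_empty]

/-- A set of elements of a finite lattice with a rank function, having the lattice-theoretic
properties of a building set that control the intersection of its members. -/
structure IsIntersectionBuilding (rk : L → ℕ) (𝒢 : Finset L) : Prop where
  strictMono : StrictMono rk
  submod : ∀ a b, rk (a ⊔ b) + rk (a ⊓ b) ≤ rk a + rk b
  bot_notMem : ⊥ ∉ 𝒢
  sup_mem : ∀ a ∈ 𝒢, ∀ b ∈ 𝒢, a ⊓ b ≠ ⊥ → a ⊔ b ∈ 𝒢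

/-- A subset of `𝒢` is closed under those joins that lie in `𝒢`. -/
def IsJoinNested (𝒢 S : Finset L) : Prop := S ⊆ 𝒢 ∧ ∀ T ⊆ S, T.sup id ∈ 𝒢 → T.sup id ∈ T

theorem IsJoinNested.subset {𝒢 S T : Finset L} (hS : IsJoinNested 𝒢 S) (h : T ⊆ S) :
    IsJoinNested 𝒢 T :=
  ⟨h.trans hS.1, fun W hW => hS.2 W (hW.trans h)⟩

theorem IsJoinNested.joinBelow_lt {𝒢 S : Finset L} (hS : IsJoinNested 𝒢 S) {F : L} (hF : F ∈ 𝒢) :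
    joinBelow S F < F := by
  refine lt_of_le_of_ne (joinBelow_le S F) fun h => ?_
  have h1 : (S.filter (· < F)).sup id = F := h
  have := hS.2 _ (Finset.filter_subset (· < F) S) (by rw [h1]; exact hF)
  rw [h1] at this
  exact lt_irrefl _ (Finset.mem_filter.1 this).2

/-- The ideal of relations of a Chow ring with variables indexed by `U`, in which the elements of
`N` count towards the joins in the exponents. -/
noncomputable def nestedIdeal (rk : L → ℕ) (U N : Finset L) : Ideal (MvPolynomial L ℚ) :=
  Ideal.span ({p | ∃ S ⊆ U, ∃ F ∈ U,
    p = (∏ H ∈ S, X H) * upSum U F ^ (rk F - rk (joinBelow (S ∪ N) F))} ∪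
      {p | ∃ H ∉ U, p = X H})

theorem nestedIdeal_le_iff {rk : L → ℕ} {U N : Finset L} {M : Submodule (MvPolynomial L ℚ)
    (MvPolynomial L ℚ)} :
    nestedIdeal rk U N ≤ M ↔
      (∀ S ⊆ U, ∀ F ∈ U,
        (∏ H ∈ S, X H) * upSum U F ^ (rk F - rk (joinBelow (S ∪ N) F)) ∈ M) ∧
      ∀ H ∉ U, X H ∈ M := by
  rw [nestedIdeal, Ideal.span, Submodule.span_le, Set.union_subset_iff]
  refine and_congr ⟨fun h S hS F hF => h ⟨S, hS, F, hF, rfl⟩, ?_⟩ ⟨fun h H hH => h ⟨H, hH, rfl⟩, ?_⟩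
  · rintro h _ ⟨S, hS, F, hF, rfl⟩
    exact h S hS F hF
  · rintro h _ ⟨H, hH, rfl⟩
    exact h H hH

theorem X_mem_nestedIdeal (rk : L → ℕ) {U : Finset L} (N : Finset L) {H : L} (hH : H ∉ U) :
    (X H : MvPolynomial L ℚ) ∈ nestedIdeal rk U N :=
  (nestedIdeal_le_iff.1 le_rfl).2 H hH

theorem prod_mul_mem_nestedIdeal {rk : L → ℕ} {U N S : Finset L} (hS : S ⊆ U) {F : L} (hF : F ∈ U)
    {e : ℕ} (he : rk F - rk (joinBelow (S ∪ N) F) ≤ e) :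
    (∏ H ∈ S, X H) * upSum U F ^ e ∈ nestedIdeal rk U N := by
  have h := (nestedIdeal_le_iff.1 (le_refl (nestedIdeal rk U N))).1 S hS F hF
  obtain ⟨k, rfl⟩ := Nat.exists_eq_add_of_le he
  rw [pow_add, ← mul_assoc]
  exact Ideal.mul_mem_right _ _ h

theorem nestedIdeal_mono {rk : L → ℕ} (hrk : Monotone rk) (U : Finset L) {N N' : Finset L}
    (h : N ⊆ N') : nestedIdeal rk U N ≤ nestedIdeal rk U N' :=
  nestedIdeal_le_iff.2 ⟨fun _ hS F hF => prod_mul_mem_nestedIdeal hS hF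
    (Nat.sub_le_sub_left (hrk (joinBelow_mono (Finset.union_subset_union_right h) F)) _),
    fun _ hH => X_mem_nestedIdeal rk N' hH⟩

/-- The relation for S = {a, b} and F = a ⊔ b has exponent zero, because both elements are strictly
below their join. -/
theorem X_mul_X_mem_nestedIdeal {rk : L → ℕ} (hrk : Monotone rk) {U : Finset L} (N : Finset L)
    {a b : L} (ha : a ∈ U) (hb : b ∈ U) (hab : a ⊔ b ∈ U) (h1 : ¬ a ≤ b) (h2 : ¬ b ≤ a) :
    (X a * X b : MvPolynomial L ℚ) ∈ nestedIdeal rk U N := by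
  have hne : a ≠ b := fun h => h1 h.le
  have := prod_mul_mem_nestedIdeal (rk := rk) (N := N) (S := {a, b})
    (Finset.insert_subset ha (Finset.singleton_subset_iff.2 hb)) hab (e := 0) ?_
  · rwa [pow_zero, mul_one, Finset.prod_pair hne] at this
  · rw [Nat.le_zero, Nat.sub_eq_zero_iff_le]
    refine hrk (sup_le (le_joinBelow (by simp) ?_) (le_joinBelow (by simp) ?_))
    · exact left_lt_sup.2 h2
    · exact right_lt_sup.2 h1

theorem joinBelow_union_insert_of_not_lt {S N : Finset L} {G F : L} (h : ¬ G < F) :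
    joinBelow (S ∪ insert G N) F = joinBelow (S ∪ N) F := by
  refine joinBelow_congr fun a ha => ?_
  have : a ≠ G := by rintro rfl; exact h ha
  simp [this]

theorem joinBelow_union_insert_of_lt {S N : Finset L} {G F : L} (h : G < F) :
    joinBelow (S ∪ insert G N) F = joinBelow (S ∪ N) F ⊔ G := by
  apply le_antisymm
  · refine joinBelow_le_iff.2 fun a ha haF => ?_
    by_cases hG : a = G
    · exact hG ▸ le_sup_right
    · exact le_sup_of_le_left (le_joinBelow (by simpa [hG] using ha) haF)
  · refine sup_le (joinBelow_mono ?_ _) (le_joinBelow (by simp) h)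
    exact Finset.union_subset_union_right (Finset.subset_insert _ _)

variable {rk : L → ℕ} {𝒢 : Finset L}

/-- Only a generator P · z^d with G < F needs an argument, where z is the sum of the variables above
F: any other generator is already in the smaller ideal. Modulo that ideal P · z^d · y = P · z^d · z,
so y^r may be replaced by z^r, and the exponent d + r is then large enough by submodularity for s
and G. -/
theorem mul_strictUpSum_pow_mem (h𝒢 : IsIntersectionBuilding rk 𝒢) {U N : Finset L} {G : L}
    (hU : U ⊆ 𝒢) (hup : ∀ a ∈ U, ∀ b ∈ 𝒢, a ≤ b → b ∈ U) (hG : G ∈ 𝒢)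
    {b : MvPolynomial L ℚ} (hb : b ∈ nestedIdeal rk U (insert G N)) :
    b * strictUpSum U G ^ (rk G - rk (joinBelow N G)) ∈ nestedIdeal rk U N := by
  set I := nestedIdeal rk U N with hI
  set y := strictUpSum U G with hy
  set r := rk G - rk (joinBelow N G) with hr
  have hrk := h𝒢.strictMono.monotone
  suffices nestedIdeal rk U (insert G N) ≤
      Submodule.comap (LinearMap.mulRight (MvPolynomial L ℚ) (y ^ r)) I by
    have h := this hb
    rwa [Submodule.mem_comap, LinearMap.mulRight_apply] at h
  refine nestedIdeal_le_iff.2 ⟨fun S hS F hF => ?_, fun H hH => ?_⟩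
  all_goals rw [Submodule.mem_comap, LinearMap.mulRight_apply]
  swap
  · exact Ideal.mul_mem_right _ I (X_mem_nestedIdeal rk N hH)
  by_cases hGF : G < F
  swap
  · rw [joinBelow_union_insert_of_not_lt hGF]
    exact Ideal.mul_mem_right _ I (prod_mul_mem_nestedIdeal hS hF le_rfl)
  rw [joinBelow_union_insert_of_lt hGF]
  set s := joinBelow (S ∪ N) F with hs
  have hsF : s ≤ F := joinBelow_le _ _
  set d := rk F - rk (s ⊔ G) with hd
  set P : MvPolynomial L ℚ := ∏ H ∈ S, X H with hP
  have hG0 : G ≠ ⊥ := fun h => h𝒢.bot_notMem (h ▸ hG)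
  have hmeet : ∀ {a c : L}, G ≤ a → G ≤ c → a ⊓ c ≠ ⊥ := fun ha hc h =>
    hG0 (le_bot_iff.1 (h ▸ le_inf ha hc))
  have hjoin : ∀ {a c : L}, a ∈ U → c ∈ U → G ≤ a → G ≤ c → a ⊔ c ∈ U := fun ha hc h1 h2 =>
    hup _ ha _ (h𝒢.sup_mem _ (hU ha) _ (hU hc) (hmeet h1 h2)) le_sup_left
  -- These x_K are the summands of y missing from the sum above F. Multiplied by x_K, that sum
  -- agrees with the sum above K ⊔ F, since x_K x_H = 0 for incomparable K, H above G. The relation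
  -- for S ∪ {K} at K ⊔ F then has exponent at most d, by submodularity for s ⊔ K and F.
  have hz : ∀ K ∈ U, G < K → ¬ F ≤ K → X K * (P * upSum U F ^ d) ∈ I := by
    intro K hK hGK hFK
    have hKF := hjoin hK hF hGK.le hGF.le
    have h1 : X K * (upSum U F - upSum U (K ⊔ F)) ∈ I := by
      have : upSum U F - upSum U (K ⊔ F) = ∑ H ∈ U.filter (fun H => F ≤ H ∧ ¬ K ≤ H), X H := by
        rw [sub_eq_iff_eq_add, upSum, upSum,
          ← Finset.sum_filter_add_sum_filter_not (U.filter (F ≤ ·)) (fun H => ¬ K ≤ H),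
          Finset.filter_filter, Finset.filter_filter]
        congr 1
        refine Finset.sum_congr (Finset.filter_congr fun H _ => ?_) fun _ _ => rfl
        rw [not_not, sup_le_iff, and_comm]
      rw [this, Finset.mul_sum]
      refine Ideal.sum_mem _ fun H hH => ?_
      obtain ⟨hHU, hFH, hKH⟩ := Finset.mem_filter.1 hH
      exact X_mul_X_mem_nestedIdeal hrk N hK hHU (hjoin hK hHU hGK.le (hGF.le.trans hFH)) hKH
        fun h => hFK (hFH.trans h)
    have h2 : X K * (upSum U F ^ d - upSum U (K ⊔ F) ^ d) ∈ I := by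
      obtain ⟨c, hc⟩ := sub_dvd_pow_sub_pow (upSum U F) (upSum U (K ⊔ F)) d
      rw [hc, ← mul_assoc]
      exact Ideal.mul_mem_right _ _ h1
    have h3 : X K * (P * upSum U (K ⊔ F) ^ d) ∈ I := by
      have hsK : s ⊔ K ≤ joinBelow (insert K S ∪ N) (K ⊔ F) := by
        refine sup_le (joinBelow_le_iff.2 fun a ha haF => le_joinBelow ?_ ?_)
          (le_joinBelow (by simp) (left_lt_sup.2 hFK))
        · rw [Finset.insert_union]; exact Finset.mem_insert_of_mem ha
        · exact haF.trans_le le_sup_right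
      have hmem := prod_mul_mem_nestedIdeal (rk := rk) (N := N) (S := insert K S)
        (Finset.insert_subset hK hS) hKF (e := d) ?_
      · by_cases hKS : K ∈ S
        · rw [Finset.insert_eq_of_mem hKS] at hmem
          exact Ideal.mul_mem_left _ _ hmem
        · rwa [Finset.prod_insert hKS, mul_assoc] at hmem
      · have e1 := hrk hsK
        have e2 := h𝒢.submod (s ⊔ K) F
        have e3 : s ⊔ K ⊔ F = K ⊔ F := by
          rw [sup_comm s K, sup_assoc, sup_eq_right.2 hsF]
        have e4 : rk (s ⊔ G) ≤ rk ((s ⊔ K) ⊓ F) :=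
          hrk (le_inf (sup_le_sup_left hGK.le s) (sup_le hsF hGF.le))
        rw [e3] at e2
        omega
    have h4 := Ideal.add_mem _ (Ideal.mul_mem_left I P h2) h3
    convert h4 using 1
    ring
  have hyz : y - upSum U F = ∑ K ∈ U.filter (fun K => G < K ∧ ¬ F ≤ K), X K := by
    rw [sub_eq_iff_eq_add, hy, strictUpSum, upSum,
      ← Finset.sum_filter_add_sum_filter_not (U.filter (G < ·)) (fun H => ¬ F ≤ H),
      Finset.filter_filter, Finset.filter_filter]
    congr 1
    refine Finset.sum_congr (Finset.filter_congr fun H _ => ?_) fun _ _ => rfl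
    rw [not_not]
    exact ⟨fun h => h.2, fun h => ⟨hGF.trans_le h, h⟩⟩
  have h5 : P * upSum U F ^ d * (y - upSum U F) ∈ I := by
    rw [hyz, Finset.mul_sum]
    refine Ideal.sum_mem _ fun K hK => ?_
    obtain ⟨hKU, hGK, hFK⟩ := Finset.mem_filter.1 hK
    rw [mul_comm]
    exact hz K hKU hGK hFK
  have h6 : P * upSum U F ^ d * (y ^ r - upSum U F ^ r) ∈ I := by
    obtain ⟨c, hc⟩ := sub_dvd_pow_sub_pow y (upSum U F) r
    rw [hc, ← mul_assoc]
    exact Ideal.mul_mem_right _ _ h5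
  have h7 : P * upSum U F ^ (d + r) ∈ I := by
    refine prod_mul_mem_nestedIdeal hS hF ?_
    have e1 := h𝒢.submod s G
    have e2 : rk (joinBelow N G) ≤ rk (s ⊓ G) := by
      refine hrk (joinBelow_le_iff.2 fun a ha haG => le_inf ?_ haG.le)
      exact le_joinBelow (Finset.mem_union_right _ ha) (haG.trans hGF)
    rw [← hs]
    omega
  have h8 := Ideal.add_mem _ h6 h7
  convert h8 using 1
  ring

/-- A violation of nestedness is a set T containing G whose join F lies in 𝒢 but not in T. Then F is
strictly above G, hence in U, and the relation for the empty S at F has exponent zero: it is 1. -/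
theorem nestedIdeal_insert_eq_top (hrk : Monotone rk) {U N : Finset L} {G : L}
    (hup : ∀ b ∈ 𝒢, G < b → b ∈ U) (hG : G ∈ 𝒢) (hN : IsJoinNested 𝒢 N)
    (h : ¬ IsJoinNested 𝒢 (insert G N)) : nestedIdeal rk U (insert G N) = ⊤ := by
  simp only [IsJoinNested, not_and, not_forall] at h
  obtain ⟨T, hT, hT𝒢, hTT⟩ := h (Finset.insert_subset hG hN.1)
  have hGT : G ∈ T := by
    by_contra hGT
    refine hTT (hN.2 T (fun x hx => ?_) hT𝒢)
    exact (Finset.mem_insert.1 (hT hx)).resolve_left (by rintro rfl; exact hGT hx)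
  have hlt : ∀ t ∈ T, t < T.sup id := fun t ht =>
    lt_of_le_of_ne (Finset.le_sup (f := id) ht) (by intro h; exact hTT (h ▸ ht))
  have := prod_mul_mem_nestedIdeal (rk := rk) (N := insert G N) (Finset.empty_subset U)
    (hup _ hT𝒢 (hlt G hGT)) (e := 0) ?_
  · rw [Ideal.eq_top_iff_one]
    simpa using this
  · rw [Nat.le_zero, Nat.sub_eq_zero_iff_le, Finset.empty_union]
    exact hrk (Finset.sup_le fun t ht => le_joinBelow (hT ht) (hlt t ht))

theorem killVar_upSum {U : Finset L} {G : L} (hG : G ∉ U) (F : L) :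
    killVar ℚ G (upSum U F) = upSum U F :=
  killVar_sum fun h => hG (Finset.filter_subset _ _ h)

theorem joinBelow_union_of_forall_not_le {U N S : Finset L} {G : L} (hmin : ∀ a ∈ U, ¬ a ≤ G)
    (hS : S ⊆ insert G U) : joinBelow (S ∪ N) G = joinBelow N G := by
  refine joinBelow_congr fun a ha => ?_
  have : a ∉ S := fun haS => by
    rcases Finset.mem_insert.1 (hS haS) with rfl | haU
    · exact lt_irrefl _ ha
    · exact hmin a haU ha.le
  simp [this]

/-- By minimality of G the relations are of three kinds: those at F = G are multiples of (X + y)^(s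
+ 1); those with F ≠ G and G ∉ S are constants from the ideal of N; those with F ≠ G and G ∈ S are X
times a constant from the ideal of `insert G N`. -/
theorem nestedIdeal_insert_le {U N : Finset L} {G : L} (hmin : ∀ a ∈ U, ¬ a ≤ G) {s : ℕ}
    (hs : rk G - rk (joinBelow N G) = s + 1)
    {hIJ : nestedIdeal rk U N ≤ nestedIdeal rk U (insert G N)}
    {h0 : ∀ b ∈ nestedIdeal rk U (insert G N), b * ((Polynomial.X + Polynomial.C (strictUpSum U G)) ^
      (s + 1) : Polynomial (MvPolynomial L ℚ)).coeff 0 ∈ nestedIdeal rk U N} :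
    nestedIdeal rk (insert G U) N ≤ Ideal.comap (splitVar ℚ G) (remainderIdeal (nestedIdeal rk U N)
      (nestedIdeal rk U (insert G N)) hIJ ((Polynomial.X + Polynomial.C (strictUpSum U G)) ^ (s + 1))
      ((Polynomial.monic_X_add_C _).pow _) s (X_add_C_pow_natDegree _ s) h0) := by
  have hGU : G ∉ U := fun h => hmin G h le_rfl
  have hky : killVar ℚ G (strictUpSum U G) = strictUpSum U G :=
    killVar_sum fun h => hGU (Finset.filter_subset _ _ h)
  refine nestedIdeal_le_iff.2 ⟨fun S hS F hF => ?_, fun H hH => ?_⟩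
  · rw [Ideal.mem_comap]
    rcases Finset.mem_insert.1 hF with rfl | hFU
    · rw [joinBelow_union_of_forall_not_le hmin hS, hs, upSum_insert_self hGU, map_mul, map_pow,
        map_add, splitVar_X_self, splitVar_of_killVar_eq hky]
      exact Ideal.mul_mem_left _ _ self_mem_remainderIdeal
    · have hFG := hmin F hFU
      rw [upSum_insert hFG]
      by_cases hGS : G ∈ S
      · have hST : insert G (S.erase G) = S := Finset.insert_erase hGS
        have hSU : S.erase G ⊆ U := fun a ha => by
          obtain ⟨h1, h2⟩ := Finset.mem_erase.1 ha
          exact (Finset.mem_insert.1 (hS h2)).resolve_left h1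
        have hSN : S ∪ N = S.erase G ∪ insert G N := by
          conv_lhs => rw [← hST]
          rw [Finset.insert_union, Finset.union_insert]
        have hk : killVar ℚ G ((∏ H ∈ S.erase G, X H) * upSum U F ^
            (rk F - rk (joinBelow (S ∪ N) F))) = (∏ H ∈ S.erase G, X H) * upSum U F ^
            (rk F - rk (joinBelow (S ∪ N) F)) := by
          rw [map_mul, map_pow, killVar_prod (Finset.notMem_erase _ _), killVar_upSum hGU]
        rw [← Finset.mul_prod_erase S _ hGS, mul_assoc, map_mul, splitVar_X_self,
          splitVar_of_killVar_eq hk]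
        refine X_mul_C_mem_remainderIdeal ?_
        rw [hSN]
        exact prod_mul_mem_nestedIdeal hSU hFU le_rfl
      · have hSU : S ⊆ U := fun a ha =>
          (Finset.mem_insert.1 (hS ha)).resolve_left (by rintro rfl; exact hGS ha)
        have hk : killVar ℚ G ((∏ H ∈ S, X H) * upSum U F ^
            (rk F - rk (joinBelow (S ∪ N) F))) = (∏ H ∈ S, X H) * upSum U F ^
            (rk F - rk (joinBelow (S ∪ N) F)) := by
          rw [map_mul, map_pow, killVar_prod hGS, killVar_upSum hGU]
        rw [splitVar_of_killVar_eq hk]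
        exact C_mem_remainderIdeal (prod_mul_mem_nestedIdeal hSU hFU le_rfl)
  · rw [Finset.mem_insert, not_or] at hH
    rw [Ideal.mem_comap, splitVar_of_killVar_eq (killVar_X_of_ne hH.1)]
    exact C_mem_remainderIdeal (X_mem_nestedIdeal rk N hH.2)

/-- Substituting x_G for X recovers p from its remainder modulo f, since f(x_G) is itself the
relation at G. The coefficients of the remainder do not involve x_G, and the relations among the
other variables lift. -/
theorem mem_nestedIdeal_insert {U N : Finset L} {G : L} (hmin : ∀ a ∈ U, ¬ a ≤ G) {s : ℕ}
    (hs : rk G - rk (joinBelow N G) = s + 1)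
    {hIJ : nestedIdeal rk U N ≤ nestedIdeal rk U (insert G N)}
    {h0 : ∀ b ∈ nestedIdeal rk U (insert G N), b * ((Polynomial.X + Polynomial.C (strictUpSum U G)) ^
      (s + 1) : Polynomial (MvPolynomial L ℚ)).coeff 0 ∈ nestedIdeal rk U N}
    {p : MvPolynomial L ℚ} (hp : splitVar ℚ G p ∈ (remainderIdeal (nestedIdeal rk U N)
      (nestedIdeal rk U (insert G N)) hIJ ((Polynomial.X + Polynomial.C (strictUpSum U G)) ^ (s + 1))
      ((Polynomial.monic_X_add_C _).pow _) s (X_add_C_pow_natDegree _ s) h0)) :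
    p ∈ nestedIdeal rk (insert G U) N := by
  have hGU : G ∉ U := fun h => hmin G h le_rfl
  have hky : killVar ℚ G (strictUpSum U G) = strictUpSum U G :=
    killVar_sum fun h => hGU (Finset.filter_subset _ _ h)
  rw [mem_remainderIdeal] at hp
  obtain ⟨f, hf⟩ : ∃ f : Polynomial (MvPolynomial L ℚ),
    f = (Polynomial.X + Polynomial.C (strictUpSum U G)) ^ (s + 1) := ⟨_, rfl⟩
  rw [← hf] at hp
  have hfm : f.Monic := hf ▸ (Polynomial.monic_X_add_C _).pow _
  set I' := nestedIdeal rk (insert G U) N with hI'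
  -- The ideal of U contains x_G because G ∉ U, whereas I' need not; x_G is therefore set to zero
  -- before comparing.
  have hkI : ∀ a ∈ nestedIdeal rk U N, killVar ℚ G a ∈ I' := by
    intro a ha
    refine (show nestedIdeal rk U N ≤ Ideal.comap (killVar ℚ G) I' from ?_) ha
    refine nestedIdeal_le_iff.2 ⟨fun S hS F hF => ?_, fun H hH => ?_⟩
    · rw [Ideal.mem_comap, map_mul, map_pow, killVar_prod fun h => hGU (hS h), killVar_upSum hGU,
        ← upSum_insert (hmin F hF)]
      exact prod_mul_mem_nestedIdeal (hS.trans (Finset.subset_insert _ _))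
        (Finset.mem_insert_of_mem hF) le_rfl
    · rw [Ideal.mem_comap]
      by_cases hHG : H = G
      · simp [killVar, hHG]
      · rw [killVar_X_of_ne hHG]
        exact X_mem_nestedIdeal rk N (by simp [hHG, hH])
  have hkJ : ∀ b ∈ nestedIdeal rk U (insert G N), X G * killVar ℚ G b ∈ I' := by
    intro b hb
    refine (show nestedIdeal rk U (insert G N) ≤ Ideal.comap (killVar ℚ G)
      (Submodule.comap (LinearMap.mulLeft (MvPolynomial L ℚ) (X G)) I') from ?_) hb
    refine nestedIdeal_le_iff.2 ⟨fun S hS F hF => ?_, fun H hH => ?_⟩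
    · rw [Ideal.mem_comap, map_mul, map_pow, killVar_prod fun h => hGU (hS h), killVar_upSum hGU,
        ← upSum_insert (hmin F hF)]
      rw [Submodule.mem_comap, LinearMap.mulLeft_apply]
      rw [← mul_assoc, ← Finset.prod_insert fun h => hGU (hS h)]
      refine prod_mul_mem_nestedIdeal (Finset.insert_subset_insert _ hS)
        (Finset.mem_insert_of_mem hF) (le_of_eq ?_)
      rw [Finset.insert_union, Finset.union_insert]
    · rw [Ideal.mem_comap]
      rw [Submodule.mem_comap, LinearMap.mulLeft_apply]
      by_cases hHG : H = G
      · simp [killVar, hHG]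
      · rw [killVar_X_of_ne hHG]
        exact Ideal.mul_mem_left _ _ (X_mem_nestedIdeal rk N (by simp [hHG, hH]))
  have hfk : f.map (killVar ℚ G : MvPolynomial L ℚ →+* MvPolynomial L ℚ) = f := by
    have : (killVar ℚ G : MvPolynomial L ℚ →+* MvPolynomial L ℚ) (strictUpSum U G) =
        strictUpSum U G := hky
    rw [hf, Polynomial.map_pow, Polynomial.map_add, Polynomial.map_X, Polynomial.map_C, this]
  have hrem : ∀ i, killVar ℚ G ((splitVar ℚ G p %ₘ f).coeff i) =
      (splitVar ℚ G p %ₘ f).coeff i := by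
    intro i
    have := congrArg (fun q => Polynomial.coeff q i) (Polynomial.map_modByMonic
      (killVar ℚ G : MvPolynomial L ℚ →+* MvPolynomial L ℚ) hfm (p := splitVar ℚ G p))
    rw [hfk, map_killVar_splitVar] at this
    simpa using this
  have hfI : f.eval (X G) ∈ I' := by
    have := prod_mul_mem_nestedIdeal (rk := rk) (N := N) (Finset.empty_subset (insert G U))
      (Finset.mem_insert_self G U) (le_of_eq (by rw [joinBelow_union_of_forall_not_le hmin (Finset.empty_subset _), hs]))
    rw [upSum_insert_self hGU] at this
    simpa [hf] using this
  rw [← eval_splitVar G p, ← Polynomial.modByMonic_add_div (splitVar ℚ G p) f,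
    Polynomial.eval_add, Polynomial.eval_mul]
  refine Ideal.add_mem _ ?_ (Ideal.mul_mem_right _ _ hfI)
  rw [Polynomial.eval_eq_sum_range]
  refine Ideal.sum_mem _ fun i _ => ?_
  cases i with
  | zero =>
    rw [pow_zero, mul_one, ← hrem]
    exact hkI _ hp.1
  | succ i =>
    rw [← hrem, pow_succ, mul_comm, mul_assoc]
    exact Ideal.mul_mem_left _ _ (hkJ _ (hp.2 i))

end NestedIdeal

/-! ### The Hilbert series as a sum over nested sets. -/

section HilbertSeries

open scoped Classical

variable {L : Type*} [Lattice L] [OrderBot L] {rk : L → ℕ} {𝒢 : Finset L}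

/-- The sum `x + x ^ 2 + ⋯ + x ^ (d - 1)`. -/
noncomputable def truncatedGeom (d : ℕ) : Polynomial ℤ :=
  ∑ i ∈ Finset.range (d - 1), Polynomial.X ^ (i + 1)

/-- The generating function of the monomials supported on nested sets `S ∪ N`, `S ⊆ U`, with
exponents bounded by the rank differences. -/
noncomputable def nestedMonomialSum (rk : L → ℕ) (𝒢 U N : Finset L) : Polynomial ℤ :=
  ∑ S ∈ U.powerset, if IsJoinNested 𝒢 (S ∪ N) then
    ∏ F ∈ S, truncatedGeom (rk F - rk (joinBelow (S ∪ N) F)) else 0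

/-- Split the subsets of `insert G U` by whether they contain G. The factor at G depends on N alone,
as nothing in U lies below G. This is the recursion that the Hilbert series satisfies. -/
theorem nestedMonomialSum_insert {U N : Finset L} {G : L} (hmin : ∀ a ∈ U, ¬ a ≤ G) :
    nestedMonomialSum rk 𝒢 (insert G U) N = nestedMonomialSum rk 𝒢 U N +
      truncatedGeom (rk G - rk (joinBelow N G)) * nestedMonomialSum rk 𝒢 U (insert G N) := by
  have hGU : G ∉ U := fun h => hmin G h le_rfl
  rw [nestedMonomialSum, Finset.sum_powerset_insert hGU, nestedMonomialSum, nestedMonomialSum,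
    Finset.mul_sum]
  congr 1
  refine Finset.sum_congr rfl fun S hS => ?_
  rw [Finset.mem_powerset] at hS
  have h1 : insert G S ∪ N = S ∪ insert G N := by rw [Finset.insert_union, Finset.union_insert]
  rw [Finset.prod_insert fun h => hGU (hS h),
    joinBelow_union_of_forall_not_le hmin (Finset.insert_subset_insert G hS), h1, mul_ite, mul_zero]

theorem nestedMonomialSum_eq_zero {U N : Finset L} (hN : ¬ IsJoinNested 𝒢 N) :
    nestedMonomialSum rk 𝒢 U N = 0 :=
  Finset.sum_eq_zero fun _ _ => if_neg fun h => hN (h.subset Finset.subset_union_right)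

theorem nestedMonomialSum_empty {N : Finset L} (hN : IsJoinNested 𝒢 N) :
    nestedMonomialSum rk 𝒢 ∅ N = 1 := by
  simp [nestedMonomialSum, hN]

open MvPolynomial in
theorem mem_nestedIdeal_empty_iff {N : Finset L} {p : MvPolynomial L ℚ} :
    p ∈ nestedIdeal rk ∅ N ↔ constantCoeff p = 0 := by
  constructor
  · intro hp
    refine (show nestedIdeal rk ∅ N ≤ RingHom.ker constantCoeff from ?_) hp
    refine nestedIdeal_le_iff.2 ⟨fun S _ F hF => absurd hF (Finset.notMem_empty F),
      fun H _ => ?_⟩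
    exact constantCoeff_X ℚ H
  · intro hp
    have : (Ideal.Quotient.mkₐ ℚ (nestedIdeal rk ∅ N)) =
        (Algebra.ofId ℚ _).comp (aeval (fun _ => (0 : ℚ))) := by
      refine algHom_ext fun i => ?_
      have := Ideal.Quotient.eq_zero_iff_mem.2
        (X_mem_nestedIdeal rk N (Finset.notMem_empty i))
      simpa using this
    have h := congrArg (fun φ => φ p) this
    have h2 : aeval (fun _ : L => (0 : ℚ)) p = 0 := by
      rw [aeval_zero', hp, map_zero]
    simp only [AlgHom.comp_apply, h2, map_zero] at h
    exact Ideal.Quotient.eq_zero_iff_mem.1 h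

open MvPolynomial in
theorem quotientHilbert_nestedIdeal_empty (N : Finset L) (n : ℕ) :
    quotientHilbert (nestedIdeal rk ∅ N) n = if n = 0 then 1 else 0 := by
  let cc : MvPolynomial L ℚ →ₗ[ℚ] ℚ := (aeval (fun _ : L => (0 : ℚ))).toLinearMap
  have hcc : ∀ p, cc p = constantCoeff p := fun p => by
    change aeval (fun _ : L => (0 : ℚ)) p = _
    rw [aeval_zero']
    rfl
  have h1 : quotientHilbert (nestedIdeal rk ∅ N) n =
      Module.finrank ℚ ((homogeneousSubmodule L ℚ n).map cc) := by
    refine finrank_map_eq_of_ker_eq _ _ _ fun p _ => ?_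
    rw [hcc, ← mem_nestedIdeal_empty_iff (rk := rk) (N := N)]
    exact Ideal.Quotient.eq_zero_iff_mem
  rw [h1]
  split_ifs with hn
  · subst hn
    have : (homogeneousSubmodule L ℚ 0).map cc = ⊤ := by
      refine eq_top_iff.2 fun x _ => ⟨C x, isHomogeneous_C L x, ?_⟩
      rw [hcc, constantCoeff_C]
    rw [this, finrank_top, Module.finrank_self]
  · have : (homogeneousSubmodule L ℚ n).map cc = ⊥ := by
      rw [eq_bot_iff, Submodule.map_le_iff_le_comap]
      intro p hp
      rw [Submodule.mem_comap, Submodule.mem_bot, hcc]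
      exact IsHomogeneous.coeff_eq_zero hp (by simpa using Ne.symm hn)
    rw [this, finrank_bot]

/-- The Hilbert series of a quotient of a polynomial ring. -/
noncomputable def quotientHilbertSeries {σ K : Type*} [Field K] (I : Ideal (MvPolynomial σ K)) :
    PowerSeries ℤ :=
  PowerSeries.mk fun n => (quotientHilbert I n : ℤ)

theorem quotientHilbertSeries_insert [Finite L] (h𝒢 : IsIntersectionBuilding rk 𝒢)
    {U N : Finset L} {G : L} (hU : U ⊆ 𝒢) (hup : ∀ a ∈ U, ∀ b ∈ 𝒢, a ≤ b → b ∈ U) (hG : G ∈ 𝒢)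
    (hmin : ∀ a ∈ U, ¬ a ≤ G) (hN : IsJoinNested 𝒢 N) :
    quotientHilbertSeries (nestedIdeal rk (insert G U) N) =
      quotientHilbertSeries (nestedIdeal rk U N) +
        (truncatedGeom (rk G - rk (joinBelow N G)) : PowerSeries ℤ) *
          quotientHilbertSeries (nestedIdeal rk U (insert G N)) := by
  -- Nestedness of N makes the join below G strictly smaller than G, so (x_G + y)^(s + 1) has
  -- positive degree.
  obtain ⟨s, hs⟩ : ∃ s, rk G - rk (joinBelow N G) = s + 1 :=
    Nat.exists_eq_add_of_lt (Nat.sub_pos_of_lt (h𝒢.strictMono (hN.joinBelow_lt hG))) |>.imp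
      fun s hs => by omega
  have hGU : G ∉ U := fun h => hmin G h le_rfl
  have h0 : ∀ b ∈ nestedIdeal rk U (insert G N),
      b * ((Polynomial.X + Polynomial.C (strictUpSum U G)) ^ (s + 1) :
        Polynomial (MvPolynomial L ℚ)).coeff 0 ∈ nestedIdeal rk U N := fun b hb => by
    rw [X_add_C_pow_coeff_zero, ← hs]
    exact mul_strictUpSum_pow_mem h𝒢 hU hup hG hb
  have hIJ := nestedIdeal_mono h𝒢.strictMono.monotone U (Finset.subset_insert G N)
  have key := quotientHilbert_adjoin G (nestedIdeal rk U N) (nestedIdeal rk U (insert G N))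
    (nestedIdeal rk (insert G U) N) hIJ
    (X_mem_nestedIdeal rk N hGU) (strictUpSum U G)
    (MvPolynomial.IsHomogeneous.sum _ _ _ fun H _ => MvPolynomial.isHomogeneous_X _ H) s h0
    (fun p => ⟨fun hp => nestedIdeal_insert_le hmin hs (hIJ := hIJ) (h0 := h0) hp,
      fun hp => mem_nestedIdeal_insert hmin hs hp⟩)
  ext n
  rw [map_add, quotientHilbertSeries, PowerSeries.coeff_mk, key, quotientHilbertSeries,
    PowerSeries.coeff_mk, Nat.cast_add, hs, truncatedGeom, Nat.add_sub_cancel]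
  congr 1
  rw [← Polynomial.coeToPowerSeries.ringHom_apply, map_sum, Finset.sum_mul, map_sum, Nat.cast_sum,
    ← Fin.sum_univ_eq_sum_range (fun i => PowerSeries.coeff n
      (Polynomial.coeToPowerSeries.ringHom (Polynomial.X ^ (i + 1) : Polynomial ℤ) *
        quotientHilbertSeries (nestedIdeal rk U (insert G N))))]
  refine Finset.sum_congr rfl fun i _ => ?_
  rw [map_pow, Polynomial.coeToPowerSeries.ringHom_apply, Polynomial.coe_X,
    PowerSeries.coeff_X_pow_mul', quotientHilbertSeries, PowerSeries.coeff_mk]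
  split_ifs <;> rfl

theorem quotientHilbertSeries_nestedIdeal [Finite L] (h𝒢 : IsIntersectionBuilding rk 𝒢)
    (U N : Finset L) (hU : U ⊆ 𝒢) (hup : ∀ a ∈ U, ∀ b ∈ 𝒢, a ≤ b → b ∈ U)
    (hN : IsJoinNested 𝒢 N) :
    quotientHilbertSeries (nestedIdeal rk U N) =
      (nestedMonomialSum rk 𝒢 U N : PowerSeries ℤ) := by
  induction hn : U.card generalizing U N with
  | zero =>
    rw [Finset.card_eq_zero] at hn
    subst hn
    rw [nestedMonomialSum_empty hN]
    ext n
    rw [quotientHilbertSeries, PowerSeries.coeff_mk, quotientHilbert_nestedIdeal_empty]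
    simp [PowerSeries.coeff_one]
  | succ k ih =>
    obtain ⟨G, hGU, hGmin⟩ := Finset.exists_minimal (s := U) (Finset.card_pos.1 (by omega))
    have hins : insert G (U.erase G) = U := Finset.insert_erase hGU
    have hU' : U.erase G ⊆ 𝒢 := (Finset.erase_subset _ _).trans hU
    have hmin : ∀ a ∈ U.erase G, ¬ a ≤ G := fun a ha h => by
      obtain ⟨h1, h2⟩ := Finset.mem_erase.1 ha
      exact h1 (le_antisymm h (hGmin h2 h))
    have hup' : ∀ a ∈ U.erase G, ∀ b ∈ 𝒢, a ≤ b → b ∈ U.erase G := fun a ha b hb hab =>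
      Finset.mem_erase.2 ⟨by rintro rfl; exact hmin a ha hab,
        hup a (Finset.erase_subset _ _ ha) b hb hab⟩
    have hcard : (U.erase G).card = k := by rw [Finset.card_erase_of_mem hGU, hn]; rfl
    rw [← hins, quotientHilbertSeries_insert h𝒢 hU' hup' (hU hGU) hmin hN,
      nestedMonomialSum_insert hmin, ih _ N hU' hup' hN hcard, Polynomial.coe_add,
      Polynomial.coe_mul]
    congr 2
    -- If N ∪ {G} is not nested, the second summand vanishes on both sides: the quotient ring is
    -- zero and the sum is empty of nested sets.
    by_cases hGN : IsJoinNested 𝒢 (insert G N)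
    · exact ih _ _ hU' hup' hGN hcard
    · rw [nestedMonomialSum_eq_zero hGN, nestedIdeal_insert_eq_top h𝒢.strictMono.monotone
        (fun b hb hGb => Finset.mem_erase.2 ⟨hGb.ne', hup G hGU b hb hGb.le⟩) (hU hGU) hN hGN]
      ext n
      simp [quotientHilbertSeries, quotientHilbert_top]

end HilbertSeries

/-! ### Cancellation from nested sets to spanning nested sets. -/

section NestedSum

open scoped Classical

/-- The elements moved by a self-map. -/
noncomputable def movedSet {L : Type*} [Fintype L] (p : L → L) : Finset L :=
  Finset.univ.filter fun G => p G ≠ G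

theorem mem_movedSet {L : Type*} [Fintype L] {p : L → L} {G : L} : G ∈ movedSet p ↔ p G ≠ G := by
  simp [movedSet]

variable {L : Type*} [Lattice L]

theorem exists_maximal_mem_above {𝒢 : Finset L} {P : L → Prop} {u : L} (hu : u ∈ 𝒢) (hPu : P u) :
    ∃ t ∈ 𝒢, P t ∧ u ≤ t ∧ ∀ v ∈ 𝒢, P v → t ≤ v → v = t := by
  obtain ⟨t, hut, ht⟩ := (𝒢.filter P).exists_le_maximal (Finset.mem_filter.2 ⟨hu, hPu⟩)
  obtain ⟨h1, h2⟩ := Finset.mem_filter.1 ht.1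
  exact ⟨t, h1, h2, hut, fun v hv hPv htv =>
    le_antisymm (ht.2 (Finset.mem_filter.2 ⟨hv, hPv⟩) htv) htv⟩

theorem joinBelow_insert_le [OrderBot L] {N : Finset L} {t G b : L} (h : joinBelow N G ≤ b)
    (ht : t < G → t ≤ b) : joinBelow (insert t N) G ≤ b := by
  refine joinBelow_le_iff.2 fun a ha haG => ?_
  rcases Finset.mem_insert.1 ha with rfl | haN
  · exact ht haG
  · exact joinBelow_le_iff.1 h a haN haG

variable [BoundedOrder L] [Fintype L]

/-- The lattice-theoretic properties of a building set used for the enumeration of nested sets. -/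
structure IsDecompositionBuilding (𝒢 : Finset L) : Prop where
  bot_notMem : ⊥ ∉ 𝒢
  sup_mem : ∀ a ∈ 𝒢, ∀ b ∈ 𝒢, a ⊓ b ≠ ⊥ → a ⊔ b ∈ 𝒢
  le_of_forall : ∀ a b : L, (∀ u ∈ 𝒢, u ≤ a → u ≤ b) → a ≤ b
  exists_le_of_le_sup : ∀ T, IsJoinNested 𝒢 T → ∀ u ∈ 𝒢, u ≤ T.sup id → ∃ t ∈ T, u ≤ t

/-- The nested sets `N` containing all elements `G` moved by `p`, such that `p G` lies in the
interval from the join of the members of `N` below `G` to `G`, for each moved `G`. -/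
structure IsCompatible (𝒢 : Finset L) (p : L → L) (N : Finset L) : Prop where
  nested : IsJoinNested 𝒢 N
  subset : movedSet p ⊆ N
  joinBelow_le : ∀ G ∈ movedSet p, joinBelow N G ≤ p G
  lt : ∀ G ∈ movedSet p, p G < G

/-- The maps sending the members of a spanning nested set `S` to the join of the members of `S`
strictly below, and fixing everything else. -/
structure IsSpanningChoice (𝒢 : Finset L) (p : L → L) : Prop where
  nested : IsJoinNested 𝒢 (movedSet p)
  spanning : (movedSet p).sup id = ⊤
  eq_joinBelow : ∀ G ∈ movedSet p, p G = joinBelow (movedSet p) G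

variable {𝒢 : Finset L} {p : L → L}

theorem IsSpanningChoice.isCompatible (hp : IsSpanningChoice 𝒢 p) :
    IsCompatible 𝒢 p (movedSet p) where
  nested := hp.nested
  subset := subset_rfl
  joinBelow_le G hG := (hp.eq_joinBelow G hG).ge
  lt G hG := hp.eq_joinBelow G hG ▸ hp.nested.joinBelow_lt (hp.nested.1 hG)

/-- Suppose N has an extra element u. Spanning gives a smallest moved F above u. Compatibility puts
u below the join of the moved elements under F, hence below one of them, contradicting minimality.
-/
theorem IsSpanningChoice.eq_movedSet (h𝒢 : IsDecompositionBuilding 𝒢) (hp : IsSpanningChoice 𝒢 p)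
    {N : Finset L} (hN : IsCompatible 𝒢 p N) : N = movedSet p := by
  refine Finset.Subset.antisymm (fun u hu => ?_) hN.subset
  by_contra huS
  have hu𝒢 := hN.nested.1 hu
  have hne : ((movedSet p).filter (u < ·)).Nonempty := by
    obtain ⟨F, hF, huF⟩ := h𝒢.exists_le_of_le_sup _ hp.nested u hu𝒢 (hp.spanning ▸ le_top)
    exact ⟨F, Finset.mem_filter.2 ⟨hF, lt_of_le_of_ne huF (by rintro rfl; exact huS hF)⟩⟩
  obtain ⟨F, hF, hFmin⟩ := Finset.exists_minimal hne
  obtain ⟨hFS, huF⟩ := Finset.mem_filter.1 hF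
  have h1 : u ≤ ((movedSet p).filter (· < F)).sup id := by
    have := (le_joinBelow hu huF).trans (hN.joinBelow_le F hFS)
    rwa [hp.eq_joinBelow F hFS] at this
  obtain ⟨t, ht, hut⟩ := h𝒢.exists_le_of_le_sup _
    (hp.nested.subset (Finset.filter_subset _ _)) u hu𝒢 h1
  obtain ⟨htS, htF⟩ := Finset.mem_filter.1 ht
  have hut' : u < t := lt_of_le_of_ne hut (by rintro rfl; exact huS htS)
  exact htF.not_ge (hFmin (Finset.mem_filter.2 ⟨htS, hut'⟩) htF.le)

theorem IsCompatible.erase {N : Finset L} (hN : IsCompatible 𝒢 p N) {t : L}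
    (ht : t ∉ movedSet p) : IsCompatible 𝒢 p (N.erase t) where
  nested := hN.nested.subset (Finset.erase_subset _ _)
  subset _ hG := Finset.mem_erase.2 ⟨by rintro rfl; exact ht hG, hN.subset hG⟩
  joinBelow_le G hG := (joinBelow_mono (Finset.erase_subset _ _) G).trans (hN.joinBelow_le G hG)
  lt := hN.lt

theorem IsCompatible.insert_of_maximal {N : Finset L} (hN : IsCompatible 𝒢 p N) {t : L}
    (ht : t ∈ 𝒢) (hmax : ∀ u ∈ 𝒢, t ≤ u → u = t) : IsCompatible 𝒢 p (insert t N) where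
  nested := by
    refine ⟨Finset.insert_subset ht hN.nested.1, fun W hW hW𝒢 => ?_⟩
    by_cases htW : t ∈ W
    · rwa [hmax _ hW𝒢 (Finset.le_sup (f := id) htW)]
    · exact hN.nested.2 W ((Finset.subset_insert_iff_of_notMem htW).1 hW) hW𝒢
  subset := hN.subset.trans (Finset.subset_insert _ _)
  joinBelow_le G hG := joinBelow_insert_le (hN.joinBelow_le G hG) fun htG =>
    absurd (hmax G (hN.nested.1 (hN.subset hG)) htG.le) htG.ne'
  lt := hN.lt

/-- For a set W through t with join in 𝒢, replacing t by G gives a subset of N whose join is again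
in 𝒢, since the join of W and G share t. Nestedness of N then forces the join of W to be G, or t by
maximality, or a member of W other than t. For the interval condition at another G' above t,
nestedness makes G and G' comparable, and G' < G would contradict maximality of t. -/
theorem IsCompatible.insert_of_maximal_below (h𝒢 : IsDecompositionBuilding 𝒢) {N : Finset L}
    (hN : IsCompatible 𝒢 p N) {t G : L} (ht : t ∈ 𝒢) (hG : G ∈ movedSet p) (htG : t ≤ p G)
    (hmax : ∀ u ∈ 𝒢, u ≤ p G → t ≤ u → u = t) : IsCompatible 𝒢 p (insert t N) where
  nested := by
    refine ⟨Finset.insert_subset ht hN.nested.1, fun W hW hW𝒢 => ?_⟩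
    by_cases htW : t ∈ W
    swap
    · exact hN.nested.2 W ((Finset.subset_insert_iff_of_notMem htW).1 hW) hW𝒢
    have hGN := hN.subset hG
    have htG' : t ≤ G := htG.trans (hN.lt G hG).le
    have htF : t ≤ W.sup id := Finset.le_sup (f := id) htW
    have ht0 : t ≠ ⊥ := fun h => h𝒢.bot_notMem (h ▸ ht)
    have hsup : (insert G (W.erase t)).sup id = W.sup id ⊔ G := by
      conv_rhs => rw [← Finset.insert_erase htW]
      rw [Finset.sup_insert, Finset.sup_insert, id, id, sup_comm t, sup_assoc,
        sup_eq_right.2 htG', sup_comm]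
    have hsub : insert G (W.erase t) ⊆ N := by
      refine Finset.insert_subset hGN fun a ha => ?_
      obtain ⟨h1, h2⟩ := Finset.mem_erase.1 ha
      exact (Finset.mem_insert.1 (hW h2)).resolve_left h1
    have hmem := hN.nested.2 _ hsub (by
      rw [hsup]
      refine h𝒢.sup_mem _ hW𝒢 _ (hN.nested.1 hGN) fun h => ht0 (le_bot_iff.1 ?_)
      rw [← h]
      exact le_inf htF htG')
    rw [hsup] at hmem
    rcases Finset.mem_insert.1 hmem with h | h
    · have hFG : W.sup id ≤ G := sup_eq_right.1 h
      by_cases hGW : G ∈ W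
      · rwa [le_antisymm hFG (Finset.le_sup (f := id) hGW)]
      · have hFp : W.sup id ≤ p G := by
          refine Finset.sup_le fun a ha => ?_
          by_cases hat : a = t
          · exact hat ▸ htG
          · refine (le_joinBelow (hsub ?_) (lt_of_le_of_ne ?_ ?_)).trans (hN.joinBelow_le G hG)
            · exact Finset.mem_insert_of_mem (Finset.mem_erase.2 ⟨hat, ha⟩)
            · exact (Finset.le_sup (f := id) ha).trans hFG
            · rintro rfl
              exact hGW ha
        rwa [hmax _ hW𝒢 hFp htF]
    · have hw := Finset.mem_of_mem_erase h
      have : W.sup id = W.sup id ⊔ G := le_antisymm le_sup_left (Finset.le_sup (f := id) hw)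
      rwa [this]
  subset := hN.subset.trans (Finset.subset_insert _ _)
  joinBelow_le G' hG' := joinBelow_insert_le (hN.joinBelow_le G' hG') fun htG' => by
    have hGN := hN.subset hG
    have hGN' := hN.subset hG'
    have ht0 : t ≠ ⊥ := fun h => h𝒢.bot_notMem (h ▸ ht)
    have htG2 : t ≤ G := htG.trans (hN.lt G hG).le
    have hmem := hN.nested.2 {G, G'} (by
      intro a ha
      rcases Finset.mem_insert.1 ha with rfl | ha
      · exact hGN
      · exact Finset.mem_singleton.1 ha ▸ hGN') (by
      rw [Finset.sup_insert, Finset.sup_singleton]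
      refine h𝒢.sup_mem _ (hN.nested.1 hGN) _ (hN.nested.1 hGN') fun h => ht0 (le_bot_iff.1 ?_)
      exact h ▸ le_inf htG2 htG'.le)
    rw [Finset.sup_insert, Finset.sup_singleton, id, id, Finset.mem_insert, Finset.mem_singleton,
      sup_eq_left, sup_eq_right] at hmem
    by_cases hGG : G = G'
    · exact hGG ▸ htG
    rcases hmem with h | h
    · have h1 := (le_joinBelow hGN' (lt_of_le_of_ne h (Ne.symm hGG))).trans (hN.joinBelow_le G hG)
      exact absurd (hmax G' (hN.nested.1 hGN') h1 htG'.le) htG'.ne'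
    · exact htG2.trans ((le_joinBelow hGN (lt_of_le_of_ne h hGG)).trans (hN.joinBelow_le G' hG'))
  lt := hN.lt

/-- If the moved set does not span, t is a maximal element of 𝒢 not below its join. Otherwise some p
G is strictly larger than the join of the moved elements below G, and t is a maximal element of 𝒢
under p G not below that join. Either way t is not moved. -/
theorem exists_toggle (h𝒢 : IsDecompositionBuilding 𝒢) (hp : ¬ IsSpanningChoice 𝒢 p)
    {N₀ : Finset L} (hN₀ : IsCompatible 𝒢 p N₀) :
    ∃ t ∈ 𝒢, t ∉ movedSet p ∧ ∀ N, IsCompatible 𝒢 p N → IsCompatible 𝒢 p (insert t N) := by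
  by_cases hs : (movedSet p).sup id = ⊤
  · obtain ⟨G, hG, hpG⟩ : ∃ G ∈ movedSet p, p G ≠ joinBelow (movedSet p) G := by
      by_contra! h
      exact hp ⟨hN₀.nested.subset hN₀.subset, hs, h⟩
    have hle : ¬ p G ≤ joinBelow (movedSet p) G := fun h =>
      hpG (le_antisymm h ((joinBelow_mono hN₀.subset G).trans (hN₀.joinBelow_le G hG)))
    obtain ⟨u, hu, hup, huj⟩ : ∃ u ∈ 𝒢, u ≤ p G ∧ ¬ u ≤ joinBelow (movedSet p) G := by
      by_contra! h
      exact hle (h𝒢.le_of_forall _ _ h)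
    obtain ⟨t, ht, htp, hut, hmax⟩ := exists_maximal_mem_above (P := (· ≤ p G)) hu hup
    exact ⟨t, ht, fun htS => huj (hut.trans (le_joinBelow htS (htp.trans_lt (hN₀.lt G hG)))),
      fun N hN => hN.insert_of_maximal_below h𝒢 ht hG htp hmax⟩
  · obtain ⟨u, hu, huj⟩ : ∃ u ∈ 𝒢, ¬ u ≤ (movedSet p).sup id := by
      by_contra! h
      exact hs (top_le_iff.1 (h𝒢.le_of_forall _ _ fun u hu _ => h u hu))
    obtain ⟨t, ht, -, hut, hmax⟩ := exists_maximal_mem_above (P := fun _ => True) hu trivial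
    exact ⟨t, ht, fun htS => huj (hut.trans (Finset.le_sup (f := id) htS)),
      fun N hN => hN.insert_of_maximal ht fun v hv => hmax v hv trivial⟩

variable {A : Type*} [CommRing A]

theorem sum_isCompatible (h𝒢 : IsDecompositionBuilding 𝒢) (p : L → L) :
    ∑ N ∈ 𝒢.powerset with IsCompatible 𝒢 p N, (-1 : A) ^ (N \ movedSet p).card =
      if IsSpanningChoice 𝒢 p then 1 else 0 := by
  split_ifs with hp
  · rw [Finset.sum_eq_single_of_mem (movedSet p)]
    · simp
    · exact Finset.mem_filter.2 ⟨Finset.mem_powerset.2 hp.nested.1, hp.isCompatible⟩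
    · intro N hN hne
      exact absurd (hp.eq_movedSet h𝒢 (Finset.mem_filter.1 hN).2) hne
  · by_cases hex : ∃ N₀, IsCompatible 𝒢 p N₀
    swap
    · refine Finset.sum_eq_zero fun N hN => absurd ⟨N, (Finset.mem_filter.1 hN).2⟩ hex
    obtain ⟨N₀, hN₀⟩ := hex
    obtain ⟨t, ht, htS, hins⟩ := exists_toggle h𝒢 hp hN₀
    -- Adding or removing t preserves compatibility and changes the exponent of -1 by one.
    refine Finset.sum_involution (fun N _ => if t ∈ N then N.erase t else insert t N) ?_ ?_ ?_ ?_
    · intro N _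
      have hcard : ∀ M : Finset L, t ∉ M →
          (insert t M \ movedSet p).card = (M \ movedSet p).card + 1 := fun M hM => by
        rw [Finset.insert_sdiff_of_notMem _ htS, Finset.card_insert_of_notMem]
        exact fun h => hM (Finset.mem_sdiff.1 h).1
      split_ifs with h
      · have := hcard (N.erase t) (Finset.notMem_erase _ _)
        rw [Finset.insert_erase h] at this
        rw [this, pow_succ]
        ring
      · rw [hcard N h, pow_succ]
        ring
    · intro N _ _
      split_ifs with h
      · intro h'
        have := Finset.notMem_erase t N
        rw [h'] at this
        exact this h
      · exact fun h' => h (h' ▸ Finset.mem_insert_self t N)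
    · intro N hN
      obtain ⟨h1, h2⟩ := Finset.mem_filter.1 hN
      have : IsCompatible 𝒢 p (if t ∈ N then N.erase t else insert t N) := by
        split_ifs with h
        · exact h2.erase htS
        · exact hins N h2
      exact Finset.mem_filter.2 ⟨Finset.mem_powerset.2 this.nested.1, this⟩
    · intro N _
      by_cases h : t ∈ N
      · simp [h]
      · simp [h]

/-- The sum over nested sets of products of interval sums reduces to the spanning nested sets. -/
theorem sum_nested_prod_sub_one (h𝒢 : IsDecompositionBuilding 𝒢) (w : L → L → A) :
    ∑ N ∈ 𝒢.powerset with IsJoinNested 𝒢 N,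
        ∏ G ∈ N, ((∑ H with joinBelow N G ≤ H ∧ H < G, w H G) - 1) =
      ∑ S ∈ 𝒢.powerset with IsJoinNested 𝒢 S ∧ S.sup id = ⊤,
        ∏ F ∈ S, w (joinBelow S F) F := by
  -- A map p encodes one term of the expanded product: p G = H < G selects w H G. The value p G = G
  -- means -1 when G ∈ N and a dummy factor 1 when G ∉ N, so that all N share the index set of
  -- self-maps.
  let f : Finset L → L → L → A := fun N G H =>
    if H = G then (if G ∈ N then -1 else 1) else
      if G ∈ N ∧ joinBelow N G ≤ H ∧ H < G then w H G else 0
  have hexpand : ∀ N : Finset L,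
      ∏ G ∈ N, ((∑ H with joinBelow N G ≤ H ∧ H < G, w H G) - 1) =
        ∑ p : L → L, ∏ G, f N G (p G) := by
    intro N
    have := Finset.prod_univ_sum (fun _ : L => (Finset.univ : Finset L)) (f N)
    rw [Fintype.piFinset_univ] at this
    rw [← this, ← Finset.prod_subset (Finset.subset_univ N)]
    · refine Finset.prod_congr rfl fun G hG => ?_
      rw [← Finset.add_sum_erase _ _ (Finset.mem_univ G), Finset.sum_filter,
        ← Finset.add_sum_erase _ _ (Finset.mem_univ G)]
      simp only [f, hG, if_true, true_and, lt_irrefl, and_false, if_false, zero_add]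
      rw [sub_eq_neg_add]
      congr 1
      exact Finset.sum_congr rfl fun H hH => by rw [if_neg (Finset.ne_of_mem_erase hH)]
    · intro G _ hG
      simp [f, hG]
  have hterm : ∀ (p : L → L) (N : Finset L), IsJoinNested 𝒢 N → ∏ G, f N G (p G) =
      if IsCompatible 𝒢 p N then
        (∏ G ∈ movedSet p, w (p G) G) * (-1 : A) ^ (N \ movedSet p).card else 0 := by
    intro p N hN
    split_ifs with hc
    · rw [← Finset.prod_mul_prod_compl (movedSet p)]
      congr 1
      · refine Finset.prod_congr rfl fun G hG => ?_
        simp only [f]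
        rw [if_neg (mem_movedSet.1 hG), if_pos ⟨hc.subset hG, hc.joinBelow_le G hG, hc.lt G hG⟩]
      · rw [← Finset.prod_const]
        refine (Finset.prod_subset_one_on_sdiff (fun G hG => ?_) (fun G hG => ?_)
          fun G hG => ?_).symm
        · exact Finset.mem_compl.2 (Finset.mem_sdiff.1 hG).2
        · simp only [Finset.mem_sdiff, Finset.mem_compl, not_and, not_not] at hG
          have h1 : p G = G := not_not.1 fun h => hG.1 (mem_movedSet.2 h)
          have h2 : G ∉ N := fun h => hG.1 (hG.2 h)
          simp [f, h1, h2]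
        · obtain ⟨h1, h2⟩ := Finset.mem_sdiff.1 hG
          have h3 : p G = G := not_not.1 fun h => h2 (mem_movedSet.2 h)
          simp [f, h1, h3]
    · by_contra hne
      have hG : ∀ G ∈ movedSet p, G ∈ N ∧ joinBelow N G ≤ p G ∧ p G < G := by
        intro G hG
        by_contra h
        refine hne (Finset.prod_eq_zero (Finset.mem_univ G) ?_)
        simp only [f]
        rw [if_neg (mem_movedSet.1 hG), if_neg h]
      exact hc ⟨hN, fun G h => (hG G h).1, fun G h => (hG G h).2.1, fun G h => (hG G h).2.2⟩
  calc _ = ∑ N ∈ 𝒢.powerset with IsJoinNested 𝒢 N, ∑ p : L → L, if IsCompatible 𝒢 p N then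
        (∏ G ∈ movedSet p, w (p G) G) * (-1 : A) ^ (N \ movedSet p).card else 0 :=
        Finset.sum_congr rfl fun N hN => (hexpand N).trans
          (Finset.sum_congr rfl fun p _ => hterm p N (Finset.mem_filter.1 hN).2)
    _ = ∑ p : L → L, (∏ G ∈ movedSet p, w (p G) G) *
        ∑ N ∈ 𝒢.powerset with IsCompatible 𝒢 p N, (-1 : A) ^ (N \ movedSet p).card := by
      rw [Finset.sum_comm]
      refine Finset.sum_congr rfl fun p _ => ?_
      rw [Finset.mul_sum, ← Finset.sum_filter, Finset.filter_filter]
      refine Finset.sum_congr (Finset.filter_congr fun N _ => ?_) fun _ _ => rfl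
      exact ⟨fun h => h.2, fun h => ⟨h.nested, h⟩⟩
    _ = ∑ p : L → L with IsSpanningChoice 𝒢 p, ∏ G ∈ movedSet p, w (p G) G := by
      rw [Finset.sum_filter]
      refine Finset.sum_congr rfl fun p _ => ?_
      rw [sum_isCompatible h𝒢, mul_ite, mul_one, mul_zero]
    _ = _ := by
      have hmoved : ∀ S, IsJoinNested 𝒢 S →
          movedSet (fun G => if G ∈ S then joinBelow S G else G) = S := by
        intro S hS
        ext G
        rw [mem_movedSet]
        by_cases h : G ∈ S
        · simpa [h] using (hS.joinBelow_lt (hS.1 h)).ne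
        · simp [h]
      refine Finset.sum_bij' (fun p _ => movedSet p)
        (fun S _ => fun G => if G ∈ S then joinBelow S G else G) ?_ ?_ ?_ ?_ ?_
      · intro p hp
        have hp := (Finset.mem_filter.1 hp).2
        exact Finset.mem_filter.2 ⟨Finset.mem_powerset.2 hp.nested.1, hp.nested, hp.spanning⟩
      · intro S hS
        obtain ⟨-, h1, h2⟩ := Finset.mem_filter.1 hS
        refine Finset.mem_filter.2 ⟨Finset.mem_univ _, ?_, ?_, ?_⟩ <;> rw [hmoved S h1]
        · exact h1
        · exact h2
        · exact fun G hG => if_pos hG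
      · intro p hp
        have hp := (Finset.mem_filter.1 hp).2
        funext G
        split_ifs with h
        · exact (hp.eq_joinBelow G h).symm
        · exact (not_not.1 fun h' => h (mem_movedSet.2 h')).symm
      · intro S hS
        exact hmoved S (Finset.mem_filter.1 hS).2.1
      · intro p hp
        have hp := (Finset.mem_filter.1 hp).2
        exact Finset.prod_congr rfl fun G hG => by rw [hp.eq_joinBelow G hG]

theorem nestedMonomialSum_eq_sum_spanning {rk : L → ℕ} (h𝒢 : IsDecompositionBuilding 𝒢)
    (w : L → L → Polynomial ℤ)
    (hw : ∀ K F, K < F → truncatedGeom (rk F - rk K) = (∑ H with K ≤ H ∧ H < F, w H F) - 1) :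
    nestedMonomialSum rk 𝒢 𝒢 ∅ =
      ∑ S ∈ 𝒢.powerset with IsJoinNested 𝒢 S ∧ S.sup id = ⊤, ∏ F ∈ S, w (joinBelow S F) F := by
  rw [← sum_nested_prod_sub_one h𝒢 w, nestedMonomialSum, Finset.sum_filter]
  refine Finset.sum_congr rfl fun N _ => ?_
  rw [Finset.union_empty]
  split_ifs with hN
  · exact Finset.prod_congr rfl fun F hF => hw _ _ (hN.joinBelow_lt (hN.1 hF))
  · rfl

end NestedSum

/-! ### Characteristic polynomials of intervals and Möbius inversion. -/

section IntervalCharPoly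

open Polynomial

variable {P Q : Type*} [PartialOrder P] [PartialOrder Q] [LocallyFiniteOrder P]
  [LocallyFiniteOrder Q] [DecidableEq P] [DecidableEq Q]

/-- The recursion for μ sees only the interval, and the image contains every interval between its
points. -/
theorem mu_map_of_ordConnected [Finite P] (f : P ↪o Q)
    (hf : ∀ a b q, f a ≤ q → q ≤ f b → q ∈ Set.range f) (a b : P) :
    IncidenceAlgebra.mu ℤ (f a) (f b) = IncidenceAlgebra.mu ℤ a b := by
  induction b using (wellFounded_lt (α := P)).induction with
  | _ b ih =>
    rw [IncidenceAlgebra.mu_apply, IncidenceAlgebra.mu_apply]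
    simp only [f.injective.eq_iff]
    split_ifs with hab
    · rfl
    · have : Finset.Ico (f a) (f b) = (Finset.Ico a b).map f.toEmbedding := by
        ext q
        simp only [Finset.mem_Ico, Finset.mem_map]
        constructor
        · rintro ⟨h1, h2⟩
          obtain ⟨c, rfl⟩ := hf a b q h1 h2.le
          exact ⟨c, ⟨f.le_iff_le.1 h1, f.lt_iff_lt.1 h2⟩, rfl⟩
        · rintro ⟨c, ⟨h1, h2⟩, rfl⟩
          exact ⟨f.le_iff_le.2 h1, f.lt_iff_lt.2 h2⟩
      rw [this, Finset.sum_map]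
      congr 1
      exact Finset.sum_congr rfl fun c hc => ih c (Finset.mem_Ico.1 hc).2

/-- The characteristic polynomial of an interval of a ranked poset. -/
noncomputable def intervalCharPoly (rk : P → ℕ) (K F : P) : ℤ[X] :=
  ∑ H ∈ Finset.Icc K F, C (IncidenceAlgebra.mu ℤ K H) * X ^ (rk F - rk H)

theorem intervalCharPoly_self (rk : P → ℕ) (F : P) : intervalCharPoly rk F F = 1 := by
  simp [intervalCharPoly]

theorem sum_intervalCharPoly (rk : P → ℕ) {K F : P} (h : K ≤ F) :
    ∑ H ∈ Finset.Icc K F, intervalCharPoly rk H F = X ^ (rk F - rk K) := by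
  have h1 : ∀ H ∈ Finset.Icc K F, intervalCharPoly rk H F = ∑ H' ∈ Finset.Icc K F,
      C (IncidenceAlgebra.mu ℤ H H') * X ^ (rk F - rk H') := by
    intro H hH
    refine Finset.sum_subset (Finset.Icc_subset_Icc (Finset.mem_Icc.1 hH).1 le_rfl) ?_
    intro H' hH' hn
    rw [IncidenceAlgebra.apply_eq_zero_of_not_le, C_0, zero_mul]
    exact fun hle => hn (Finset.mem_Icc.2 ⟨hle, (Finset.mem_Icc.1 hH').2⟩)
  rw [Finset.sum_congr rfl h1, Finset.sum_comm]
  have h2 : ∀ H' ∈ Finset.Icc K F, ∑ H ∈ Finset.Icc K F,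
      C (IncidenceAlgebra.mu ℤ H H') * X ^ (rk F - rk H') =
      if H' = K then X ^ (rk F - rk K) else 0 := by
    intro H' hH'
    rw [← Finset.sum_mul, ← map_sum]
    have : ∑ H ∈ Finset.Icc K F, IncidenceAlgebra.mu ℤ H H' =
        ∑ H ∈ Finset.Icc K H', IncidenceAlgebra.mu ℤ H H' := by
      refine (Finset.sum_subset (Finset.Icc_subset_Icc le_rfl (Finset.mem_Icc.1 hH').2) ?_).symm
      intro H hH hn
      exact IncidenceAlgebra.apply_eq_zero_of_not_le
        (fun hle => hn (Finset.mem_Icc.2 ⟨(Finset.mem_Icc.1 hH).1, hle⟩)) _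
    rw [this, IncidenceAlgebra.sum_Icc_mu_left]
    by_cases hK : H' = K
    · subst hK
      simp
    · rw [if_neg (Ne.symm hK), if_neg hK, C_0, zero_mul]
  rw [Finset.sum_congr rfl h2, Finset.sum_ite_eq', if_pos (Finset.left_mem_Icc.2 h)]

theorem mul_intervalCharPoly_divByMonic (rk : P → ℕ) {K F : P} (h : K ≠ F) :
    (X - C 1) * (intervalCharPoly rk K F /ₘ (X - C 1)) = intervalCharPoly rk K F := by
  rw [mul_divByMonic_eq_iff_isRoot, IsRoot.def, intervalCharPoly, eval_finsetSum]
  have := IncidenceAlgebra.sum_Icc_mu_right (𝕜 := ℤ) K F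
  rw [if_neg h] at this
  simpa using this

/-- Multiply by x - 1. The right side becomes x^d - 1 from `sum_intervalCharPoly` without its term H
= F, minus x - 1; the left side telescopes to x^d - x. -/
theorem truncatedGeom_eq_sum_intervalCharPoly {rk : P → ℕ} (hrk : StrictMono rk) {K F : P}
    (h : K < F) :
    truncatedGeom (rk F - rk K) =
      (∑ H ∈ Finset.Ico K F, intervalCharPoly rk H F /ₘ (X - C 1)) - 1 := by
  have hX : (X - C 1 : ℤ[X]) ≠ 0 := X_sub_C_ne_zero 1
  refine mul_left_cancel₀ hX ?_
  rw [mul_sub, Finset.mul_sum, Finset.sum_congr rfl fun H hH =>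
    mul_intervalCharPoly_divByMonic rk (Finset.mem_Ico.1 hH).2.ne]
  have h1 := sum_intervalCharPoly rk h.le
  rw [← Finset.Ico_insert_right h.le, Finset.sum_insert Finset.right_notMem_Ico,
    intervalCharPoly_self] at h1
  obtain ⟨d, hd⟩ : ∃ d, rk F - rk K = d + 1 := ⟨rk F - rk K - 1, by have := hrk h; omega⟩
  rw [hd] at h1 ⊢
  have h2 : (X - C 1 : ℤ[X]) * truncatedGeom (d + 1) = X ^ (d + 1) - X := by
    rw [truncatedGeom, Nat.add_sub_cancel]
    simp_rw [pow_succ]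
    rw [← Finset.sum_mul, ← mul_assoc, C_1, mul_geom_sum]
    ring
  rw [h2, ← h1, C_1]
  ring

end IntervalCharPoly

/-! ### The two descriptions of nested sets. -/

section NestedCriterion

open scoped Classical

variable {L : Type*} [Lattice L] [OrderBot L] {𝒢 S : Finset L}

/-- The maximal elements of T form an antichain with the same join. If that join is in 𝒢 there is
only one of them, the empty case being excluded by ⊥ ∉ 𝒢. -/
theorem isJoinNested_iff (h𝒢 : ⊥ ∉ 𝒢) : IsJoinNested 𝒢 S ↔ S ⊆ 𝒢 ∧ ∀ T ⊆ S, 2 ≤ T.card →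
    IsAntichain (· ≤ ·) (T : Set L) → T.sup id ∉ 𝒢 := by
  refine and_congr_right fun hS => ⟨fun h T hT hc ha hmem => ?_, fun h T hT hmem => ?_⟩
  · have h1 := h T hT hmem
    obtain ⟨b, hb, hbne⟩ := Finset.exists_mem_ne (s := T) (by omega) (T.sup id)
    exact ha hb h1 hbne (Finset.le_sup (f := id) hb)
  · set T' := T.filter fun a => Maximal (· ∈ T) a with hT'
    have hsup : T'.sup id = T.sup id := by
      refine le_antisymm (Finset.sup_mono (Finset.filter_subset _ _)) (Finset.sup_le fun a ha => ?_)
      obtain ⟨b, hab, hb⟩ := T.exists_le_maximal ha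
      exact hab.trans (Finset.le_sup (f := id) (Finset.mem_filter.2 ⟨hb.1, hb⟩))
    have hanti : IsAntichain (· ≤ ·) (T' : Set L) := by
      intro a ha b hb hne hab
      have ha' := (Finset.mem_filter.1 (Finset.mem_coe.1 ha)).2
      have hb' := (Finset.mem_filter.1 (Finset.mem_coe.1 hb)).1
      exact hne (le_antisymm hab (ha'.2 hb' hab))
    have hcard : T'.card ≤ 1 := by
      by_contra hc
      exact h T' ((Finset.filter_subset _ _).trans hT) (by omega) hanti (hsup ▸ hmem)
    rcases T'.eq_empty_or_nonempty with he | ⟨a, ha⟩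
    · rw [he, Finset.sup_empty] at hsup
      exact absurd (hsup ▸ hmem) h𝒢
    · have : T' = {a} := Finset.eq_singleton_iff_unique_mem.2
        ⟨ha, fun b hb => Finset.card_le_one.1 hcard b hb a ha⟩
      rw [this, Finset.sup_singleton, id] at hsup
      exact hsup ▸ (Finset.mem_filter.1 ha).1

end NestedCriterion

/-! ### Passing between variables indexed by 𝒢 and by all flats. -/

section VariableTransport

open scoped Classical
open MvPolynomial

variable {σ K : Type*} [Field K]

theorem quotientHilbert_eq_of_subtype (s : Finset σ) (I : Ideal (MvPolynomial σ K))
    (J : Ideal (MvPolynomial s K)) (hX : ∀ i ∉ s, X i ∈ I)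
    (hJ : J ≤ I.comap (rename (R := K) (Subtype.val : s → σ)))
    (hI : I ≤ J.comap (aeval (R := K) fun i => if h : i ∈ s then X (⟨i, h⟩ : s) else 0))
    (n : ℕ) : quotientHilbert J n = quotientHilbert I n := by
  let ψ : MvPolynomial σ K →ₐ[K] MvPolynomial s K :=
    aeval fun i => if h : i ∈ s then X (⟨i, h⟩ : s) else 0
  let r : MvPolynomial s K →ₐ[K] MvPolynomial σ K := rename Subtype.val
  have hψr : ∀ q, ψ (r q) = q := by
    intro q
    have : ψ.comp r = AlgHom.id K _ := by
      refine algHom_ext fun i => ?_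
      simp [ψ, r]
    exact congrArg (fun φ => φ q) this
  have hrψ : ∀ p, p - r (ψ p) ∈ I := by
    intro p
    have : (Ideal.Quotient.mkₐ K I).comp (r.comp ψ) = Ideal.Quotient.mkₐ K I := by
      refine algHom_ext fun i => ?_
      by_cases h : i ∈ s
      · simp [ψ, r, h]
      · simpa [ψ, h] using (Ideal.Quotient.eq_zero_iff_mem.2 (hX i h)).symm
    exact Ideal.Quotient.eq.1 (congrArg (fun φ => φ p) this).symm
  have hmap : (homogeneousSubmodule σ K n).map ψ.toLinearMap = homogeneousSubmodule s K n := by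
    apply le_antisymm
    · rintro _ ⟨p, hp, rfl⟩
      have hp' : p.IsHomogeneous n := hp
      have := hp'.aeval (n := 1) (fun i => if h : i ∈ s then X (R := K) (⟨i, h⟩ : s) else 0)
        (fun i => by
          split_ifs
          · exact isHomogeneous_X _ _
          · exact isHomogeneous_zero _ _ _)
      rwa [one_mul] at this
    · intro q hq
      exact ⟨r q, IsHomogeneous.rename_isHomogeneous hq, hψr q⟩
  rw [quotientHilbert, quotientHilbert, ← hmap, ← Submodule.map_comp]
  refine finrank_map_eq_of_ker_eq _ _ _ fun p _ => ?_
  have h1 : ((Ideal.Quotient.mkₐ K J).toLinearMap ∘ₗ ψ.toLinearMap) p = 0 ↔ ψ p ∈ J :=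
    Ideal.Quotient.eq_zero_iff_mem
  have h2 : (Ideal.Quotient.mkₐ K I).toLinearMap p = 0 ↔ p ∈ I :=
    Ideal.Quotient.eq_zero_iff_mem
  rw [h1, h2]
  refine ⟨fun h => ?_, fun h => hI h⟩
  have := I.add_mem (hrψ p) (hJ h)
  rwa [sub_add_cancel] at this

end VariableTransport

/-! ### Rank on the lattice of flats. -/

namespace Polymatroid

variable {α : Type*} [DecidableEq α] (M : Polymatroid α)

/-- A maximal superset of A of rank at most that of A is a flat, so it contains the closure. -/
theorem rk_closure {A : Finset α} (hA : A ⊆ M.ground) : M.rk (M.closure A) = M.rk A := by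
  refine le_antisymm ?_ (M.rk_mono _ _ (M.subset_closure hA) (M.isFlat_closure A).1)
  obtain ⟨B, hAB, hB⟩ := (M.ground.powerset.filter fun B => M.rk B ≤ M.rk A).exists_le_maximal
    (Finset.mem_filter.2 ⟨Finset.mem_powerset.2 hA, le_rfl⟩)
  obtain ⟨hBg, hBr⟩ := Finset.mem_filter.1 hB.1
  rw [Finset.mem_powerset] at hBg
  have hflat : M.IsFlat B := by
    refine ⟨hBg, fun e he => ?_⟩
    obtain ⟨heg, heB⟩ := Finset.mem_sdiff.1 he
    by_contra hlt
    have hins : insert e B ⊆ M.ground := Finset.insert_subset heg hBg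
    have := hB.2 (Finset.mem_filter.2 ⟨Finset.mem_powerset.2 hins, by omega⟩)
      (Finset.subset_insert e B)
    exact heB (this (Finset.mem_insert_self e B))
  exact (M.rk_mono _ _ (M.closure_subset hflat hAB) hBg).trans hBr

theorem rk_flat_strictMono : StrictMono fun F : M.Flat => M.rk F.1 := by
  intro F G h
  obtain ⟨hFG, hGF⟩ := Finset.ssubset_iff_subset_ne.1 (show F.1 ⊂ G.1 from h)
  obtain ⟨e, heG, heF⟩ := Finset.exists_of_ssubset (show F.1 ⊂ G.1 from h)
  exact (F.2.2 e (Finset.mem_sdiff.2 ⟨G.2.1 heG, heF⟩)).trans_le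
    (M.rk_mono _ _ (Finset.insert_subset heG hFG) G.2.1)

theorem rk_flat_submod (F G : M.Flat) :
    M.rk (F ⊔ G).1 + M.rk (F ⊓ G).1 ≤ M.rk F.1 + M.rk G.1 := by
  have h1 : M.rk (F ⊔ G).1 = M.rk (F.1 ∪ G.1) := M.rk_closure (Finset.union_subset F.2.1 G.2.1)
  rw [h1]
  exact M.rk_submod _ _ F.2.1 G.2.1

/-! ### Flats of a minor as an interval of flats. -/

section Minor

variable {M} {K F : M.Flat} (h : K ≤ F)

theorem isFlat_union_of_isFlat_minor {A : Finset α} (hA : (M.minor K F h).IsFlat A) :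
    M.IsFlat (A ∪ K.1) := by
  have hAF : A ∪ K.1 ⊆ F.1 := Finset.union_subset (hA.1.trans Finset.sdiff_subset) h
  refine ⟨hAF.trans F.2.1, fun e he => ?_⟩
  obtain ⟨heg, heA⟩ := Finset.mem_sdiff.1 he
  by_cases heF : e ∈ F.1
  · have h1 : M.rk (A ∪ K.1) - M.rk K.1 < M.rk (insert e A ∪ K.1) - M.rk K.1 :=
      hA.2 e (Finset.mem_sdiff.2 ⟨Finset.mem_sdiff.2 ⟨heF, fun h => heA (Finset.mem_union_right _ h)⟩,
        fun h => heA (Finset.mem_union_left _ h)⟩)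
    rw [Finset.insert_union] at h1
    omega
  -- For e outside F, submodularity bounds the rank increase at A ∪ K below by the positive increase
  -- at F.
  · have h1 := M.rk_submod (insert e (A ∪ K.1)) F.1
      (Finset.insert_subset heg (hAF.trans F.2.1)) F.2.1
    have h2 := F.2.2 e (Finset.mem_sdiff.2 ⟨heg, heF⟩)
    rw [Finset.insert_union, Finset.union_eq_right.2 hAF,
      Finset.insert_inter_of_notMem heF, Finset.inter_eq_left.2 hAF] at h1
    omega

theorem isFlat_minor_sdiff {H : M.Flat} (hKH : K ≤ H) (hHF : H ≤ F) :
    (M.minor K F h).IsFlat (H.1 \ K.1) := by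
  have hKH' : K.1 ⊆ H.1 := hKH
  refine ⟨Finset.sdiff_subset_sdiff hHF subset_rfl, fun e he => ?_⟩
  obtain ⟨he1, he2⟩ := Finset.mem_sdiff.1 he
  have he1' : e ∈ F.1 \ K.1 := he1
  obtain ⟨heF, heK⟩ := Finset.mem_sdiff.1 he1'
  have heH : e ∉ H.1 := fun h => he2 (Finset.mem_sdiff.2 ⟨h, heK⟩)
  change M.rk (H.1 \ K.1 ∪ K.1) - M.rk K.1 < M.rk (insert e (H.1 \ K.1) ∪ K.1) - M.rk K.1
  rw [Finset.insert_union, Finset.sdiff_union_of_subset hKH']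
  have h1 := H.2.2 e (Finset.mem_sdiff.2 ⟨F.2.1 heF, heH⟩)
  have h2 := M.rk_mono K.1 H.1 hKH' H.2.1
  omega

/-- Flats of the minor `M|_F / K` as flats of `M` between `K` and `F`. -/
def minorFlatEmbedding : (M.minor K F h).Flat ↪o M.Flat :=
  OrderEmbedding.ofMapLEIff (fun A => ⟨A.1 ∪ K.1, isFlat_union_of_isFlat_minor h A.2⟩) fun A B => by
    have hA : Disjoint A.1 K.1 := Finset.disjoint_of_subset_left A.2.1 Finset.sdiff_disjoint
    constructor
    · intro hAB x hx
      exact (Finset.mem_union.1 (hAB (Finset.mem_union_left _ hx))).resolve_right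
        (Finset.disjoint_left.1 hA hx)
    · exact fun hAB => Finset.union_subset_union_left hAB

theorem minorFlatEmbedding_mem_Icc (A : (M.minor K F h).Flat) :
    K ≤ minorFlatEmbedding h A ∧ minorFlatEmbedding h A ≤ F :=
  ⟨Finset.subset_union_right, Finset.union_subset (A.2.1.trans Finset.sdiff_subset) h⟩

theorem exists_minorFlatEmbedding_eq {H : M.Flat} (hKH : K ≤ H) (hHF : H ≤ F) :
    ∃ A, minorFlatEmbedding h A = H :=
  ⟨⟨H.1 \ K.1, isFlat_minor_sdiff h hKH hHF⟩, Subtype.ext (Finset.sdiff_union_of_subset hKH)⟩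

theorem minorFlatEmbedding_bot : minorFlatEmbedding h ⊥ = K := by
  obtain ⟨A, hA⟩ := exists_minorFlatEmbedding_eq h le_rfl h
  exact le_antisymm (((minorFlatEmbedding h).le_iff_le.2 (bot_le (a := A))).trans hA.le)
    (minorFlatEmbedding_mem_Icc h ⊥).1

theorem charPoly_minor :
    (M.minor K F h).charPoly = intervalCharPoly (fun H : M.Flat => M.rk H.1) K F := by
  rw [charPoly, intervalCharPoly]
  have hIcc : Finset.Icc K F = Finset.univ.map (minorFlatEmbedding h).toEmbedding := by
    ext H
    simp only [Finset.mem_Icc, Finset.mem_map, Finset.mem_univ, true_and]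
    constructor
    · exact fun hH => exists_minorFlatEmbedding_eq h hH.1 hH.2
    · rintro ⟨A, rfl⟩
      exact minorFlatEmbedding_mem_Icc h A
  rw [hIcc, Finset.sum_map]
  refine Finset.sum_congr rfl fun A _ => ?_
  have hmu := mu_map_of_ordConnected (minorFlatEmbedding h) (fun a b q ha hb =>
    exists_minorFlatEmbedding_eq h ((minorFlatEmbedding_mem_Icc h a).1.trans ha)
      (hb.trans (minorFlatEmbedding_mem_Icc h b).2)) ⊥ A
  rw [minorFlatEmbedding_bot] at hmu
  congr 2
  · exact hmu.symm
  · change (M.rk (F.1 \ K.1 ∪ K.1) - M.rk K.1) - (M.rk (A.1 ∪ K.1) - M.rk K.1) =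
      M.rk F.1 - M.rk (A.1 ∪ K.1)
    rw [Finset.sdiff_union_of_subset h]
    have := M.rk_mono K.1 (A.1 ∪ K.1) Finset.subset_union_right
      (isFlat_union_of_isFlat_minor h A.2).1
    omega

end Minor

/-! ### Lattice properties of building sets, and assembly of the formula. -/

section BuildingSet

variable {M} {𝒢 : Finset M.Flat}

theorem IsBuildingSet.bot_notMem (hM : M.Loopless) (h𝒢 : M.IsBuildingSet 𝒢) : ⊥ ∉ 𝒢 :=
  fun h => h𝒢.1 _ h (bot_val hM)

theorem exists_le_factor {X u : M.Flat} (hu : u ∈ 𝒢) (huX : u ≤ X) :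
    ∃ G ∈ M.factors {G | G ∈ 𝒢 ∧ G ≤ X}, u ≤ G := by
  obtain ⟨G, huG, hG⟩ := (Set.toFinite {G | G ∈ 𝒢 ∧ G ≤ X}).exists_le_maximal
    (show u ∈ {G | G ∈ 𝒢 ∧ G ≤ X} from ⟨hu, huX⟩)
  exact ⟨G, hG, huG⟩

theorem IsBuildingSet.isLUB_factors (h𝒢 : M.IsBuildingSet 𝒢) (X : M.Flat) :
    IsLUB (M.factors {G | G ∈ 𝒢 ∧ G ≤ X}) X := by
  obtain ⟨⟨φ, hφ⟩, -⟩ := h𝒢.2 X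
  have h := hφ ⊤
  rw [map_top] at h
  have hr : Set.range (fun G : M.factors {G | G ∈ 𝒢 ∧ G ≤ X} => G.1) =
      M.factors {G | G ∈ 𝒢 ∧ G ≤ X} := Subtype.range_coe
  rw [← hr]
  exact h

open scoped Classical in
-- The tuples with G₁ ⊓ G₂ in coordinate G₁, respectively G₂, and ⊥ elsewhere have the same join, so
-- they coincide.
theorem IsBuildingSet.factors_inf_eq_bot (h𝒢 : M.IsBuildingSet 𝒢) {X G₁ G₂ : M.Flat}
    (h₁ : G₁ ∈ M.factors {G | G ∈ 𝒢 ∧ G ≤ X}) (h₂ : G₂ ∈ M.factors {G | G ∈ 𝒢 ∧ G ≤ X})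
    (hne : G₁ ≠ G₂) : G₁ ⊓ G₂ = ⊥ := by
  obtain ⟨⟨φ, hφ⟩, -⟩ := h𝒢.2 X
  have key : ∀ (G : M.factors {G | G ∈ 𝒢 ∧ G ≤ X}) (x : Set.Iic G.1),
      (φ (Function.update ⊥ G x)).1 = x.1 := by
    intro G x
    refine (hφ _).unique ⟨?_, fun b hb => ?_⟩
    · rintro _ ⟨G', rfl⟩
      by_cases hG : G' = G
      · subst hG
        simp
      · simp [Function.update_of_ne hG]
    · simpa using hb ⟨G, rfl⟩
  have h3 := key ⟨G₁, h₁⟩ ⟨G₁ ⊓ G₂, Set.mem_Iic.2 inf_le_left⟩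
  have h4 := key ⟨G₂, h₂⟩ ⟨G₁ ⊓ G₂, Set.mem_Iic.2 inf_le_right⟩
  have h5 := congrFun (φ.injective (Subtype.ext (h3.trans h4.symm))) ⟨G₁, h₁⟩
  rw [Function.update_self, Function.update_of_ne fun h => hne (congrArg Subtype.val h)] at h5
  exact congrArg Subtype.val h5

theorem IsBuildingSet.sup_mem (h𝒢 : M.IsBuildingSet 𝒢) {a b : M.Flat} (ha : a ∈ 𝒢) (hb : b ∈ 𝒢)
    (hab : a ⊓ b ≠ ⊥) : a ⊔ b ∈ 𝒢 := by
  obtain ⟨G₁, h₁, ha₁⟩ := exists_le_factor (X := a ⊔ b) ha le_sup_left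
  obtain ⟨G₂, h₂, hb₂⟩ := exists_le_factor (X := a ⊔ b) hb le_sup_right
  have : G₁ = G₂ := by
    by_contra hne
    refine hab (le_bot_iff.1 ?_)
    rw [← h𝒢.factors_inf_eq_bot h₁ h₂ hne]
    exact inf_le_inf ha₁ hb₂
  subst this
  have hG : G₁ = a ⊔ b := le_antisymm h₁.1.2 (sup_le ha₁ hb₂)
  exact hG ▸ h₁.1.1

theorem IsBuildingSet.isIntersectionBuilding (hM : M.Loopless) (h𝒢 : M.IsBuildingSet 𝒢) :
    IsIntersectionBuilding (fun F : M.Flat => M.rk F.1) 𝒢 where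
  strictMono := M.rk_flat_strictMono
  submod := M.rk_flat_submod
  bot_notMem := h𝒢.bot_notMem hM
  sup_mem _ ha _ hb := h𝒢.sup_mem ha hb

open scoped Classical in
-- Let G be the factor of the join of T that contains u. Grouping the members of T by the factors
-- above them gives a tuple with join the top, hence the top tuple. So G is the join of the members
-- of T below it, and nestedness gives G ∈ T.
theorem IsBuildingSet.exists_le_of_le_sup (h𝒢 : M.IsBuildingSet 𝒢)
    {T : Finset M.Flat} (hT : IsJoinNested 𝒢 T) {u : M.Flat} (hu : u ∈ 𝒢) (huT : u ≤ T.sup id) :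
    ∃ t ∈ T, u ≤ t := by
  set X := T.sup id with hX
  obtain ⟨G, hG, huG⟩ := exists_le_factor hu huT
  obtain ⟨⟨φ, hφ⟩, -⟩ := h𝒢.2 X
  let a : (G : M.factors {G | G ∈ 𝒢 ∧ G ≤ X}) → Set.Iic G.1 := fun G =>
    ⟨(T.filter (· ≤ G.1)).sup id, Set.mem_Iic.2 (Finset.sup_le fun t ht => (Finset.mem_filter.1 ht).2)⟩
  have ha : φ a = ⊤ := by
    refine top_le_iff.1 (show X ≤ (φ a).1 from Finset.sup_le fun t ht => ?_)
    obtain ⟨G', hG', htG'⟩ := exists_le_factor (hT.1 ht)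
      (show t ≤ X from Finset.le_sup (f := id) ht)
    exact (Finset.le_sup (f := id) (Finset.mem_filter.2 ⟨ht, htG'⟩)).trans
      ((hφ a).1 ⟨⟨G', hG'⟩, rfl⟩)
  have ha' : a = ⊤ := φ.injective (ha.trans (map_top φ).symm)
  have hGsup : (T.filter (· ≤ G)).sup id = G := congrArg Subtype.val (congrFun ha' ⟨G, hG⟩)
  have hmem := hT.2 _ (Finset.filter_subset (· ≤ G) T) (hGsup.symm ▸ hG.1.1)
  rw [hGsup] at hmem
  exact ⟨G, (Finset.mem_filter.1 hmem).1, huG⟩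

theorem IsBuildingSet.isDecompositionBuilding (hM : M.Loopless) (h𝒢 : M.IsBuildingSet 𝒢) :
    IsDecompositionBuilding 𝒢 where
  bot_notMem := h𝒢.bot_notMem hM
  sup_mem _ ha _ hb := h𝒢.sup_mem ha hb
  le_of_forall X _ hb := (h𝒢.isLUB_factors X).2 fun G hG => hb G hG.1.1 hG.1.2
  exists_le_of_le_sup _ hT _ hu huT := h𝒢.exists_le_of_le_sup hT hu huT

theorem isNested_iff_isJoinNested (h𝒢 : ⊥ ∉ 𝒢) {S : Finset M.Flat} :
    M.IsNested 𝒢 S ↔ IsJoinNested 𝒢 S :=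
  (isJoinNested_iff h𝒢).symm

theorem supBelow_eq_joinBelow (S : Finset M.Flat) (F : M.Flat) :
    M.supBelow S F = joinBelow S F := by
  rw [supBelow, joinBelow]
  congr!

open MvPolynomial in
theorem rename_chowGenerator (𝒢 : Finset M.Flat) (S : Finset 𝒢) (G : 𝒢) (n : ℕ) :
    rename (Subtype.val : 𝒢 → M.Flat) ((∏ H ∈ S, X H) *
      (∑ H : 𝒢 with G ≤ H, X H) ^ n : MvPolynomial 𝒢 ℚ) =
      (∏ H ∈ S.map (Function.Embedding.subtype _), X H) * upSum 𝒢 G.1 ^ n := by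
  rw [map_mul, map_pow, map_prod, map_sum, Finset.prod_map, upSum]
  congr 1
  · exact Finset.prod_congr rfl fun H _ => by simp
  · congr 1
    rw [Finset.sum_filter, Finset.sum_filter, ← Finset.sum_coe_sort 𝒢]
    refine Finset.sum_congr rfl fun H _ => ?_
    rw [rename_X]
    split_ifs <;> first | rfl | contradiction

open MvPolynomial in
theorem quotientHilbert_chowIdeal (𝒢 : Finset M.Flat) (n : ℕ) :
    quotientHilbert (M.chowIdeal 𝒢) n =
      quotientHilbert (nestedIdeal (fun F : M.Flat => M.rk F.1) 𝒢 ∅) n := by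
  refine quotientHilbert_eq_of_subtype 𝒢 _ _ (fun i hi => X_mem_nestedIdeal _ _ hi) ?_ ?_ n
  · rw [chowIdeal, Ideal.span_le]
    rintro _ ⟨S, G, rfl⟩
    rw [SetLike.mem_coe, Ideal.mem_comap, rename_chowGenerator]
    refine prod_mul_mem_nestedIdeal (fun x hx => ?_) G.2 (le_of_eq ?_)
    · obtain ⟨H, -, rfl⟩ := Finset.mem_map.1 hx
      exact H.2
    · rw [joinBelow_union_empty, supBelow_eq_joinBelow]
  · refine nestedIdeal_le_iff.2 ⟨fun S hS F hF => ?_, fun H hH => ?_⟩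
    · have hmap : (S.subtype (· ∈ 𝒢)).map (Function.Embedding.subtype _) = S := by
        rw [Finset.subtype_map, Finset.filter_true_of_mem fun x hx => hS hx]
      have h := rename_chowGenerator 𝒢 (S.subtype (· ∈ 𝒢)) ⟨F, hF⟩
        (M.rk F.1 - M.rk (joinBelow S F).1)
      rw [hmap] at h
      rw [joinBelow_union_empty, ← h, Ideal.mem_comap, aeval_rename]
      have hid : ∀ φ : MvPolynomial 𝒢 ℚ →ₐ[ℚ] MvPolynomial 𝒢 ℚ, (∀ i, φ (X i) = X i) →
          ∀ p, φ p = p := fun φ hφ p =>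
        congrArg (fun ψ => ψ p) (algHom_ext (g := AlgHom.id ℚ _) hφ)
      rw [hid _ fun i => by simp]
      refine Ideal.subset_span ⟨S.subtype (· ∈ 𝒢), ⟨F, hF⟩, ?_⟩
      rw [hmap, supBelow_eq_joinBelow]
    · rw [Ideal.mem_comap, aeval_X, dif_neg hH]
      exact Ideal.zero_mem _

theorem reducedCharPoly_minor {K F : M.Flat} (h : K ≤ F) : (M.minor K F h).reducedCharPoly =
    intervalCharPoly (fun H : M.Flat => M.rk H.1) K F /ₘ (Polynomial.X - Polynomial.C 1) := by
  rw [reducedCharPoly, charPoly_minor]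

theorem nestedMonomialSum_eq_sum_spanningNestedSets (hM : M.Loopless) (h𝒢 : M.IsBuildingSet 𝒢) :
    nestedMonomialSum (fun F : M.Flat => M.rk F.1) 𝒢 𝒢 ∅ =
      ∑ S ∈ M.spanningNestedSets 𝒢, ∏ F ∈ S,
        (M.minor (M.supBelow S F) F (M.supBelow_le S F)).reducedCharPoly := by
  rw [nestedMonomialSum_eq_sum_spanning (h𝒢.isDecompositionBuilding hM) fun K F : M.Flat =>
    intervalCharPoly (fun H : M.Flat => M.rk H.1) K F /ₘ (Polynomial.X - Polynomial.C 1)]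
  · refine Finset.sum_congr ?_ fun S _ => Finset.prod_congr rfl fun F _ => ?_
    · rw [spanningNestedSets]
      ext S
      refine (@Finset.mem_filter _ _ (_) _ _).trans
        (Iff.trans ?_ (@Finset.mem_filter _ _ (_) _ _).symm)
      rw [isNested_iff_isJoinNested (h𝒢.bot_notMem hM), IsSpanning, ← M.top_val, Subtype.ext_iff]
    · rw [reducedCharPoly_minor, supBelow_eq_joinBelow]
  · intro K F hKF
    rw [truncatedGeom_eq_sum_intervalCharPoly M.rk_flat_strictMono hKF]
    congr 1
    refine Finset.sum_congr ?_ fun _ _ => rfl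
    ext H
    simp

end BuildingSet

end Polymatroid

theorem theorem1p3 {α : Type*} [DecidableEq α] (M : Polymatroid α) (hM : M.Loopless)
    (𝒢 : Finset M.Flat) (h𝒢 : M.IsBuildingSet 𝒢) :
    M.hilbertSeries 𝒢 =
      ((∑ S ∈ M.spanningNestedSets 𝒢, ∏ F ∈ S,
        (M.minor (M.supBelow S F) F (M.supBelow_le S F)).reducedCharPoly : Polynomial ℤ) :
          PowerSeries ℤ) := by
  have h : M.hilbertSeries 𝒢 =
      quotientHilbertSeries (nestedIdeal (fun F : M.Flat => M.rk F.1) 𝒢 ∅) := by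
    ext n
    rw [Polymatroid.hilbertSeries, quotientHilbertSeries, PowerSeries.coeff_mk, PowerSeries.coeff_mk,
      ← Polymatroid.quotientHilbert_chowIdeal]
    rfl
  have hempty : IsJoinNested 𝒢 ∅ := ⟨Finset.empty_subset _, fun T hT hmem => by
    rw [Finset.subset_empty.1 hT, Finset.sup_empty] at hmem
    exact absurd hmem (h𝒢.bot_notMem hM)⟩
  rw [h, quotientHilbertSeries_nestedIdeal (h𝒢.isIntersectionBuilding hM) 𝒢 ∅ subset_rfl
    (fun _ _ b hb _ => hb) hempty, Polymatroid.nestedMonomialSum_eq_sum_spanningNestedSets hM h𝒢]
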